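/- Let $A$ be a totally ordered integral domain. **Definitions.** A *torsion-free $f$-algebra* over $A$ is a commutative $A$-algebra $S$ with $1$ and a lattice order that makes it an $f$-ring, such that $as\ge 0$ whenever $0\le a\in A$ and $0\le s\in S$, and such that $as=0$ ($a\in A$, $s\in S$) implies $a=0$ or $s=0$. A *proximity* on $S$ is a binary relation $\prec$ such that: $0\prec 0$ and $1\prec 1$; $s\prec t$ implies $s\le t$; $s\le t\prec r\le u$ implies $s\prec u$; $s\prec t,r$ implies $s\prec t\wedge r$; $s\prec t$ implies $-t\prec -s$; $s\prec t$ and $r\prec u$ imply $s+r\prec t+u$; for $0<a\in A$, $s\prec t$ if and only if $as\prec at$; $s\prec t$ and $r\prec u$ with $s,t,r,u\ge0$ imply $sr\prec tu$; $s\prec t$ implies $s\prec r\prec t$ for some $r$; and every $s>0$ has some $0<t\prec s$. A *proximity Specker $A$-algebra* is a pair $(S,\prec)$ of a torsion-free $f$-algebra $S$ over $A$ and a proximity on it, such that $S$ is generated as an $A$-algebra by a Boolean subalgebra $B$ of the Boolean algebra $\mathrm{Id}(S)$ of its idempotents with every nonzero $e\in B$ faithful ($ae=0$ implies $a=0$ for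 $a\in A$). $S$ is *Baer* if the annihilator of each subset of $S$ is an ideal generated by an idempotent. A map $\sigma:\mathrm{Id}(S)\to\mathrm{Id}(T)$ is a *de Vries morphism* if $\sigma(0)=0$; $\sigma(e\wedge k)=\sigma(e)\wedge\sigma(k)$; $e\prec k$ implies $\neg\sigma(\neg e)\prec\sigma(k)$; and $\sigma(e)$ is the least upper bound of $\{\sigma(k):k\prec e\}$ in $\mathrm{Id}(T)$. A map $\alpha:S\to T$ is a *proximity morphism* if for all $s,t\in S$ and $a\in A$: $\alpha(0)=0$; $\alpha(s\wedge t)=\alpha(s)\wedge\alpha(t)$; $s\prec t$ implies $-\alpha(-s)\prec\alpha(t)$; $\alpha(s)$ is the least upper bound of $\{\alpha(t):t\prec s\}$; $\alpha(s+a)=\alpha(s)+a$; $\alpha(as)=a\alpha(s)$ if $a>0$; and $\alpha(s\vee a)=\alpha(s)\vee a$. An ideal $I$ of the Boolean algebra $\mathrm{Id}(S)$ is *round* if $I=\{e: e\prec k\text{ for some }k\in I\}$; an *end* of $(\mathrm{Id}(S),\prec)$ is a maximal element among the proper round ideals. The space of ends has as basis the sets $\{x: e\in x\}$, $e\in\mathrm{Id}(S)$.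 Put $\zeta_S(e)=\{x:\neg e\in x\}$. For a topological space $X$, let $FN(X)$ be the set of functions $f:X\to A$ with finite image such that $f^{-1}({\uparrow}a)$ is regular open for all $a\in A$, where ${\uparrow}a=\{b\in A:a\le b\}$. For $f:X\to A$ with finite image, $f^\#\in FN(X)$ denotes its *normalization*, the function with $(f^\#)^{-1}({\uparrow}a)=\mathrm{Int}(\mathrm{Cl}(f^{-1}({\uparrow}a)))$ for all $a$. $FN(X)$ is an $A$-algebra under the normalized pointwise operations and a lattice under the pointwise order, and $f\prec_X g$ means $\mathrm{Cl}(f^{-1}({\uparrow}a))\subseteq g^{-1}({\uparrow}a)$ for all $a\in A$. A continuous map $\varphi:X\to Y$ induces $\varphi^*:FN(Y)\to FN(X)$, $\varphi^*(f)=(f\circ\varphi)^\#$. **Theorem.** Let $(S,\prec)$ and $(T,\prec)$ be proximity Specker $A$-algebras, let $X$ be the space of ends of $(\mathrm{Id}(T),\prec)$ and $Y$ the space of ends of $(\mathrm{Id}(S),\prec)$. There are (necessarily unique) $A$-algebra homomorphisms $\eta_S:S\to FN(Y)$ and $\eta_T:T\to FN(X)$ that send each idempotent $e$ to the characteristic function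 of $\zeta_S(e)$, respectively $\zeta_T(e)$. Both are injective lattice homomorphisms, preserve and reflect the proximity, and have dense image (whenever $f\prec g$ in the target, $f\prec h\prec g$ for some $h$ in the image). With these maps: (A) For every map $\alpha:S\to T$ the following are equivalent: 1. $\alpha$ is a proximity morphism; 2. $\alpha$ restricts to a de Vries morphism $\mathrm{Id}(S)\to\mathrm{Id}(T)$, and $\alpha\bigl(a_0+\sum_{i=1}^n b_ie_i\bigr)=a_0+\sum_{i=1}^n b_i\alpha(e_i)$ for all $n\ge 0$, $a_0\in A$, $0<b_1,\dots,b_n\in A$ and idempotents $1>e_1>\cdots>e_n>0$ of $S$; 3. there is a continuous map $\varphi:X\to Y$ such that $\eta_T\circ\alpha=\varphi^*\circ\eta_S$. (B) Every de Vries morphism $\sigma:\mathrm{Id}(S)\to\mathrm{Id}(T)$ extends to a unique proximity morphism $S\to T$. (C) If $S$ and $T$ are Baer, there are bijections $\alpha\mapsto\sigma\mapsto\varphi$ from the proximity morphisms $S\to T$ to the de Vries morphisms $\mathrm{Id}(S)\to\mathrm{Id}(T)$ and from these to the continuous maps $X\to Y$, with $\sigma=\alpha|_{\mathrm{Id}(S)}$,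 $\zeta_T(\sigma(e))=\mathrm{Int}(\mathrm{Cl}(\varphi^{-1}(\zeta_S(e))))$ for all $e\in\mathrm{Id}(S)$, and $\eta_T\circ\alpha=\varphi^*\circ\eta_S$. -/

import Mathlib

open Set Topology Filter

namespace DeVriesPower

noncomputable section

/-! ### Proximities on Boolean algebras, de Vries morphisms, ends -/

section Boolean

variable {B C : Type*} [BooleanAlgebra B] [BooleanAlgebra C]

/-- A map between Boolean algebras equipped with proximities is a de Vries morphism. -/
structure IsDeVriesMorphism (precB : B → B → Prop) (precC : C → C → Prop) (σ : B → C) : Prop where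
  map_bot : σ ⊥ = ⊥
  map_inf : ∀ a b, σ (a ⊓ b) = σ a ⊓ σ b
  map_prec : ∀ a b, precB a b → precC (σ aᶜ)ᶜ (σ b)
  isLUB : ∀ a, IsLUB (σ '' {b | precB b a}) (σ a)

/-- An ideal `I` is round if it consists of the elements proximal to an element of `I`. -/
def IsRound (prec : B → B → Prop) (I : Order.Ideal B) : Prop :=
  (I : Set B) = {a | ∃ e ∈ I, prec a e}

/-- The ends: the maximal elements among the proper round ideals. -/
def EndSpace (prec : B → B → Prop) : Type _ :=
  {I : Order.Ideal B // Maximal (fun J : Order.Ideal B => IsRound prec J ∧ J.IsProper) I}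

/-- The topology on the space of ends with basis the sets `{x | a ∈ x}`, for `a` in `B`. -/
instance (prec : B → B → Prop) : TopologicalSpace (EndSpace prec) :=
  TopologicalSpace.generateFrom (range fun a : B => {x : EndSpace prec | a ∈ x.1})

/-- The set of ends (as maximal round ideals) that contain the complement of `e`. Under the
correspondence `x ↦ {b | bᶜ ∈ x}` between maximal round ideals and maximal round filters, it is
the set of maximal round filters that contain `e`. -/
def zeta (prec : B → B → Prop) (e : B) : Set (EndSpace prec) := {x | eᶜ ∈ x.1}

end Boolean

/-! ### Finitely valued normal functions -/

section Normal

set_option linter.unusedSectionVars false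

variable (X A : Type*) [TopologicalSpace X] [LinearOrder A]

/-- Finitely valued normal functions `X → A`: the preimage of each `{b | a ≤ b}` is
regular open. -/
structure FN where
  toFun : X → A
  finite_range : (range toFun).Finite
  regular : ∀ a : A, interior (closure (toFun ⁻¹' Ici a)) = toFun ⁻¹' Ici a

variable {X A}

namespace FN

instance : FunLike (FN X A) X A where
  coe := FN.toFun
  coe_injective f g h := by cases f; cases g; congr

@[ext] theorem ext {f g : FN X A} (h : ∀ x, f x = g x) : f = g := DFunLike.ext _ _ h

theorem finite (f : FN X A) : (range f).Finite := f.finite_range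

theorem reg (f : FN X A) (a : A) : interior (closure (f ⁻¹' Ici a)) = f ⁻¹' Ici a := f.regular a

theorem isOpen_preimage (f : FN X A) (a : A) : IsOpen (f ⁻¹' Ici a) := by
  rw [← f.reg a]; exact isOpen_interior

end FN

theorem exists_normal_value (f : X → A) (hf : (range f).Finite) (x : X) :
    ∃ a ∈ range f, x ∈ interior (closure (f ⁻¹' Ici a)) := by
  obtain ⟨a, ⟨ha, hmin⟩⟩ := hf.exists_minimal ⟨f x, mem_range_self x⟩
  refine ⟨a, ha, ?_⟩
  have : f ⁻¹' Ici a = univ := by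
    ext y
    simp only [mem_preimage, mem_Ici, mem_univ, iff_true]
    rcases le_total a (f y) with h | h
    · exact h
    · exact hmin (mem_range_self y) h
  rw [this]; simp

open scoped Classical in
/-- The value at `x` of the normalization of `f`: the largest value `a` of `f` for which `x` lies
in the interior of the closure of `{y | a ≤ f y}`. -/
def normalizeFun (f : X → A) (hf : (range f).Finite) (x : X) : A :=
  (hf.toFinset.filter fun a => x ∈ interior (closure (f ⁻¹' Ici a))).max' (by
    obtain ⟨a, ha, hx⟩ := exists_normal_value f hf x
    exact ⟨a, by simp only [Finset.mem_filter, Finite.mem_toFinset]; exact ⟨ha, hx⟩⟩)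

open scoped Classical in
theorem normalizeFun_spec (f : X → A) (hf : (range f).Finite) (x : X) :
    normalizeFun f hf x ∈ range f ∧
      x ∈ interior (closure (f ⁻¹' Ici (normalizeFun f hf x))) := by
  have h := Finset.max'_mem (hf.toFinset.filter fun a => x ∈ interior (closure (f ⁻¹' Ici a))) (by
    obtain ⟨a, ha, hx⟩ := exists_normal_value f hf x
    exact ⟨a, by simp only [Finset.mem_filter, Finite.mem_toFinset]; exact ⟨ha, hx⟩⟩)
  simp only [Finset.mem_filter, Finite.mem_toFinset] at h
  exact h

theorem le_normalizeFun_iff (f : X → A) (hf : (range f).Finite) (x : X) (a : A) :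
    a ≤ normalizeFun f hf x ↔ x ∈ interior (closure (f ⁻¹' Ici a)) := by
  classical
  constructor
  · intro h
    exact interior_mono (closure_mono (preimage_mono (Ici_subset_Ici.2 h)))
      (normalizeFun_spec f hf x).2
  · intro h
    have hne : ({b | b ∈ range f ∧ a ≤ b} : Set A).Nonempty := by
      have : (f ⁻¹' Ici a).Nonempty := closure_nonempty_iff.1 ⟨x, interior_subset h⟩
      obtain ⟨y, hy⟩ := this
      exact ⟨f y, mem_range_self y, hy⟩
    obtain ⟨b, ⟨⟨hbr, hab⟩, hmin⟩⟩ := (hf.subset (sep_subset _ _)).exists_minimal hne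
    have heq : f ⁻¹' Ici a = f ⁻¹' Ici b := by
      ext y
      simp only [mem_preimage, mem_Ici]
      refine ⟨fun hy => ?_, fun hy => hab.trans hy⟩
      rcases le_total b (f y) with h' | h'
      · exact h'
      · exact hmin ⟨mem_range_self y, hy⟩ h'
    refine hab.trans (Finset.le_max' _ _ ?_)
    simp only [Finset.mem_filter, Finite.mem_toFinset]
    exact ⟨hbr, heq ▸ h⟩

/-- The normalization of a finitely valued function. -/
def normalize (f : X → A) (hf : (range f).Finite) : FN X A where
  toFun := normalizeFun f hf
  finite_range := hf.subset (by rintro _ ⟨x, rfl⟩; exact (normalizeFun_spec f hf x).1)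
  regular a := by
    have : normalizeFun f hf ⁻¹' Ici a = interior (closure (f ⁻¹' Ici a)) := by
      ext x; exact le_normalizeFun_iff f hf x a
    rw [this, interior_closure_idem]

theorem le_normalize_iff (f : X → A) (hf : (range f).Finite) (x : X) (a : A) :
    a ≤ normalize f hf x ↔ x ∈ interior (closure (f ⁻¹' Ici a)) :=
  le_normalizeFun_iff f hf x a

/-- The set of points near which `f` is constant. -/
def constSet (f : X → A) : Set X := {x | ∀ᶠ y in 𝓝 x, f y = f x}

theorem isOpen_constSet (f : X → A) : IsOpen (constSet f) := by
  rw [isOpen_iff_mem_nhds]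
  intro x hx
  have hx' : ∀ᶠ y in 𝓝 x, f y = f x := hx
  filter_upwards [eventually_eventually_nhds.2 hx', hx'] with y hy hyx
  show ∀ᶠ z in 𝓝 y, f z = f y
  filter_upwards [hy] with z hz
  rw [hz, hyx]

theorem dense_constSet (f : FN X A) : Dense (constSet f) := by
  rw [dense_iff_inter_open]
  intro V hV hne
  obtain ⟨_, ⟨⟨y, hy, rfl⟩, hmax⟩⟩ :=
    (f.finite.subset (image_subset_range f V)).exists_maximal (hne.image f)
  refine ⟨y, hy, ?_⟩
  have hmem : V ∩ f ⁻¹' Ici (f y) ∈ 𝓝 y :=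
    (hV.inter (f.isOpen_preimage _)).mem_nhds ⟨hy, le_refl (f y)⟩
  show ∀ᶠ z in 𝓝 y, f z = f y
  filter_upwards [hmem] with z hz
  exact le_antisymm (hmax (mem_image_of_mem f hz.1) hz.2) hz.2

theorem normalize_apply_of_mem {f : X → A} (hf : (range f).Finite) {x : X}
    (hx : x ∈ constSet f) : normalize f hf x = f x := by
  have hx' : ∀ᶠ y in 𝓝 x, f y = f x := hx
  refine eq_of_forall_le_iff fun a => ?_
  rw [le_normalize_iff]
  constructor
  · intro h
    obtain ⟨y, hy1, hy2⟩ := mem_closure_iff_nhds.1 (interior_subset h) _ hx'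
    have hy1' : f y = f x := hy1
    rw [← hy1']; exact hy2
  · intro h
    refine interior_mono subset_closure (mem_interior_iff_mem_nhds.2 ?_)
    filter_upwards [hx'] with y hy
    show a ≤ f y
    rw [hy]; exact h

theorem mem_constSet_normalize {f : X → A} (hf : (range f).Finite) {x : X}
    (hx : x ∈ constSet f) : x ∈ constSet (normalize f hf) := by
  show ∀ᶠ y in 𝓝 x, normalize f hf y = normalize f hf x
  have hx' : ∀ᶠ y in 𝓝 x, f y = f x := hx
  filter_upwards [(isOpen_constSet f).mem_nhds hx, hx'] with y hy hyx
  rw [normalize_apply_of_mem hf hy, normalize_apply_of_mem hf hx, hyx]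

theorem FN.le_of_dense {f g : FN X A} {D : Set X} (hD : Dense D) (h : ∀ x ∈ D, f x ≤ g x)
    (x : X) : f x ≤ g x := by
  have hx : x ∈ f ⁻¹' Ici (f x) := le_refl (f x)
  rw [← f.reg] at hx
  have hsub : closure (f ⁻¹' Ici (f x)) ⊆ closure (g ⁻¹' Ici (f x)) := by
    refine closure_minimal ?_ isClosed_closure
    refine (hD.open_subset_closure_inter (f.isOpen_preimage _)).trans (closure_mono ?_)
    rintro y ⟨hy1, hy2⟩
    exact le_trans (show f x ≤ f y from hy1) (h y hy2)
  have := interior_mono hsub hx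
  rw [g.reg] at this
  exact this

theorem FN.ext_of_dense {f g : FN X A} {D : Set X} (hD : Dense D) (h : ∀ x ∈ D, f x = g x) :
    f = g :=
  FN.ext fun x => le_antisymm (FN.le_of_dense hD (fun y hy => (h y hy).le) x)
    (FN.le_of_dense hD (fun y hy => (h y hy).ge) x)

theorem finite_range_op₂ (op : A → A → A) (f g : FN X A) :
    (range fun x => op (f x) (g x)).Finite :=
  (f.finite.image2 op g.finite).subset (by
    rintro _ ⟨x, rfl⟩; exact mem_image2_of_mem (mem_range_self x) (mem_range_self x))

theorem finite_range_op₁ (op : A → A) (f : FN X A) : (range fun x => op (f x)).Finite :=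
  (f.finite.image op).subset (by rintro _ ⟨x, rfl⟩; exact mem_image_of_mem op (mem_range_self x))

/-- The binary operation on normal functions induced by `op`: the normalization of the pointwise
operation. -/
def lift₂ (op : A → A → A) (f g : FN X A) : FN X A :=
  normalize (fun x => op (f x) (g x)) (finite_range_op₂ op f g)

/-- The unary operation on normal functions induced by `op`. -/
def lift₁ (op : A → A) (f : FN X A) : FN X A :=
  normalize (fun x => op (f x)) (finite_range_op₁ op f)

/-- The constant functions. -/
def FN.const (a : A) : FN X A where
  toFun _ := a
  finite_range := (finite_singleton a).subset (by rintro _ ⟨x, rfl⟩; rfl)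
  regular b := by by_cases h : b ≤ a <;> simp [preimage, h]

theorem mem_constSet_op₂ (op : A → A → A) {f g : FN X A} {x : X} (hf : x ∈ constSet f)
    (hg : x ∈ constSet g) : x ∈ constSet fun x => op (f x) (g x) := by
  have hf' : ∀ᶠ y in 𝓝 x, f y = f x := hf
  have hg' : ∀ᶠ y in 𝓝 x, g y = g x := hg
  show ∀ᶠ y in 𝓝 x, op (f y) (g y) = op (f x) (g x)
  filter_upwards [hf', hg'] with y h1 h2
  rw [h1, h2]

theorem mem_constSet_op₁ (op : A → A) {f : FN X A} {x : X} (hf : x ∈ constSet f) :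
    x ∈ constSet fun x => op (f x) := by
  have hf' : ∀ᶠ y in 𝓝 x, f y = f x := hf
  show ∀ᶠ y in 𝓝 x, op (f y) = op (f x)
  filter_upwards [hf'] with y h1
  rw [h1]

theorem lift₂_apply (op : A → A → A) {f g : FN X A} {x : X} (hf : x ∈ constSet f)
    (hg : x ∈ constSet g) : lift₂ op f g x = op (f x) (g x) :=
  normalize_apply_of_mem _ (mem_constSet_op₂ op hf hg)

theorem lift₁_apply (op : A → A) {f : FN X A} {x : X} (hf : x ∈ constSet f) :
    lift₁ op f x = op (f x) :=
  normalize_apply_of_mem _ (mem_constSet_op₁ op hf)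

theorem lift₂_mem (op : A → A → A) {f g : FN X A} {x : X} (hf : x ∈ constSet f)
    (hg : x ∈ constSet g) : x ∈ constSet (lift₂ op f g) :=
  mem_constSet_normalize _ (mem_constSet_op₂ op hf hg)

theorem lift₁_mem (op : A → A) {f : FN X A} {x : X} (hf : x ∈ constSet f) :
    x ∈ constSet (lift₁ op f) :=
  mem_constSet_normalize _ (mem_constSet_op₁ op hf)

theorem const_apply (a : A) (x : X) : FN.const a x = a := rfl

theorem const_mem (a : A) (x : X) : x ∈ constSet (FN.const a : FN X A) :=
  Eventually.of_forall fun _ => rfl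

theorem FN.ext₁ {f g : FN X A} (p : FN X A) (h : ∀ x ∈ constSet p, f x = g x) : f = g :=
  FN.ext_of_dense (dense_constSet p) h

theorem FN.ext₂ {f g : FN X A} (p q : FN X A)
    (h : ∀ x, x ∈ constSet p → x ∈ constSet q → f x = g x) : f = g :=
  FN.ext_of_dense ((dense_constSet p).inter_of_isOpen_left (dense_constSet q) (isOpen_constSet p))
    fun x hx => h x hx.1 hx.2

theorem FN.ext₃ {f g : FN X A} (p q r : FN X A)
    (h : ∀ x, x ∈ constSet p → x ∈ constSet q → x ∈ constSet r → f x = g x) : f = g :=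
  FN.ext_of_dense (((dense_constSet p).inter_of_isOpen_left (dense_constSet q)
    (isOpen_constSet p)).inter_of_isOpen_right (dense_constSet r) (isOpen_constSet r))
    fun x hx => h x hx.1.1 hx.1.2 hx.2

/-- The pointwise order, with pointwise meet; the join is the normalized pointwise join. -/
instance : Lattice (FN X A) where
  __ := PartialOrder.lift (fun f : FN X A => (f : X → A)) DFunLike.coe_injective
  inf f g :=
    { toFun := fun x => f x ⊓ g x
      finite_range := finite_range_op₂ _ f g
      regular := fun a => by
        have : (fun x => f x ⊓ g x) ⁻¹' Ici a = f ⁻¹' Ici a ∩ g ⁻¹' Ici a := by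
          ext x; simp
        rw [this]
        refine Subset.antisymm ?_ ?_
        · nth_rewrite 2 [← f.reg a]
          nth_rewrite 2 [← g.reg a]
          rw [← interior_inter]
          exact interior_mono (closure_inter_subset_inter_closure _ _)
        · exact ((f.isOpen_preimage a).inter (g.isOpen_preimage a)).subset_interior_closure }
  inf_le_left f g x := inf_le_left (a := f x)
  inf_le_right f g x := inf_le_right (a := f x)
  le_inf f g h h1 h2 x := le_inf (h1 x) (h2 x)
  sup := lift₂ (· ⊔ ·)
  le_sup_left f g x := FN.le_of_dense
    ((dense_constSet f).inter_of_isOpen_left (dense_constSet g) (isOpen_constSet f))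
    (fun y hy => by rw [lift₂_apply _ hy.1 hy.2]; exact le_sup_left) x
  le_sup_right f g x := FN.le_of_dense
    ((dense_constSet f).inter_of_isOpen_left (dense_constSet g) (isOpen_constSet f))
    (fun y hy => by rw [lift₂_apply _ hy.1 hy.2]; exact le_sup_right) x
  sup_le f g h h1 h2 x := FN.le_of_dense
    ((dense_constSet f).inter_of_isOpen_left (dense_constSet g) (isOpen_constSet f))
    (fun y hy => by rw [lift₂_apply _ hy.1 hy.2]; exact sup_le (h1 y) (h2 y)) x

/-- The canonical proximity on normal functions. -/
def FN.prec (f g : FN X A) : Prop := ∀ a : A, closure (f ⁻¹' Ici a) ⊆ g ⁻¹' Ici a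

/-- The map on normal functions induced by a continuous map: the normalization of the
composition. -/
def FN.pullback {Y : Type*} [TopologicalSpace Y] (φ : C(X, Y)) (f : FN Y A) : FN X A :=
  normalize (fun x => f (φ x)) (f.finite.subset (by rintro _ ⟨x, rfl⟩; exact mem_range_self _))

end Normal

section NormalRing

variable {X A : Type*} [TopologicalSpace X] [CommRing A] [LinearOrder A]

/-! The ring structure on normal functions: the operations are the normalized pointwise
operations. -/

instance : Add (FN X A) := ⟨lift₂ (· + ·)⟩

instance : Mul (FN X A) := ⟨lift₂ (· * ·)⟩

instance : Neg (FN X A) := ⟨lift₁ (- ·)⟩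

instance : Zero (FN X A) := ⟨FN.const 0⟩

instance : One (FN X A) := ⟨FN.const 1⟩

instance : CommRing (FN X A) where
  nsmul := nsmulRec
  zsmul := zsmulRec
  add_assoc f g h := FN.ext₃ f g h fun x hf hg hh => by
    show lift₂ _ (lift₂ _ f g) h x = lift₂ _ f (lift₂ _ g h) x
    rw [lift₂_apply _ (lift₂_mem _ hf hg) hh, lift₂_apply _ hf hg,
      lift₂_apply _ hf (lift₂_mem _ hg hh), lift₂_apply _ hg hh, add_assoc]
  zero_add f := FN.ext₁ f fun x hf => by
    show lift₂ _ (FN.const 0) f x = f x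
    rw [lift₂_apply _ (const_mem 0 x) hf, const_apply, zero_add]
  add_zero f := FN.ext₁ f fun x hf => by
    show lift₂ _ f (FN.const 0) x = f x
    rw [lift₂_apply _ hf (const_mem 0 x), const_apply, add_zero]
  add_comm f g := FN.ext₂ f g fun x hf hg => by
    show lift₂ _ f g x = lift₂ _ g f x
    rw [lift₂_apply _ hf hg, lift₂_apply _ hg hf, add_comm]
  neg_add_cancel f := FN.ext₁ f fun x hf => by
    show lift₂ _ (lift₁ _ f) f x = FN.const 0 x
    rw [lift₂_apply _ (lift₁_mem _ hf) hf, lift₁_apply _ hf, const_apply, neg_add_cancel]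
  mul_assoc f g h := FN.ext₃ f g h fun x hf hg hh => by
    show lift₂ _ (lift₂ _ f g) h x = lift₂ _ f (lift₂ _ g h) x
    rw [lift₂_apply _ (lift₂_mem _ hf hg) hh, lift₂_apply _ hf hg,
      lift₂_apply _ hf (lift₂_mem _ hg hh), lift₂_apply _ hg hh, mul_assoc]
  one_mul f := FN.ext₁ f fun x hf => by
    show lift₂ _ (FN.const 1) f x = f x
    rw [lift₂_apply _ (const_mem 1 x) hf, const_apply, one_mul]
  mul_one f := FN.ext₁ f fun x hf => by
    show lift₂ _ f (FN.const 1) x = f x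
    rw [lift₂_apply _ hf (const_mem 1 x), const_apply, mul_one]
  mul_comm f g := FN.ext₂ f g fun x hf hg => by
    show lift₂ _ f g x = lift₂ _ g f x
    rw [lift₂_apply _ hf hg, lift₂_apply _ hg hf, mul_comm]
  zero_mul f := FN.ext₁ f fun x hf => by
    show lift₂ _ (FN.const 0) f x = FN.const 0 x
    rw [lift₂_apply _ (const_mem 0 x) hf, const_apply, zero_mul]
  mul_zero f := FN.ext₁ f fun x hf => by
    show lift₂ _ f (FN.const 0) x = FN.const 0 x
    rw [lift₂_apply _ hf (const_mem 0 x), const_apply, mul_zero]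
  left_distrib f g h := FN.ext₃ f g h fun x hf hg hh => by
    show lift₂ _ f (lift₂ _ g h) x = lift₂ _ (lift₂ _ f g) (lift₂ _ f h) x
    rw [lift₂_apply _ hf (lift₂_mem _ hg hh), lift₂_apply _ hg hh,
      lift₂_apply _ (lift₂_mem _ hf hg) (lift₂_mem _ hf hh), lift₂_apply _ hf hg,
      lift₂_apply _ hf hh, mul_add]
  right_distrib f g h := FN.ext₃ f g h fun x hf hg hh => by
    show lift₂ _ (lift₂ _ f g) h x = lift₂ _ (lift₂ _ f h) (lift₂ _ g h) x
    rw [lift₂_apply _ (lift₂_mem _ hf hg) hh, lift₂_apply _ hf hg,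
      lift₂_apply _ (lift₂_mem _ hf hh) (lift₂_mem _ hg hh), lift₂_apply _ hf hh,
      lift₂_apply _ hg hh, add_mul]

/-- The `A`-algebra structure on normal functions: the elements of `A` act through the constant
functions, by normalized pointwise multiplication. -/
instance : Algebra A (FN X A) where
  smul a := lift₁ (a * ·)
  algebraMap :=
    { toFun := FN.const
      map_one' := rfl
      map_zero' := rfl
      map_mul' := fun a b => FN.ext fun x =>
        (lift₂_apply (· * ·) (const_mem a x) (const_mem b x)).symm
      map_add' := fun a b => FN.ext fun x =>
        (lift₂_apply (· + ·) (const_mem a x) (const_mem b x)).symm }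
  commutes' _ _ := mul_comm _ _
  smul_def' a f := FN.ext₁ f fun x hf => by
    show lift₁ _ f x = lift₂ (· * ·) (FN.const a) f x
    rw [lift₁_apply _ hf, lift₂_apply _ (const_mem a x) hf, const_apply]

end NormalRing

/-! ### Proximity Specker algebras -/

/-- The idempotents of a commutative ring. As a type of its own, it carries only the Boolean order
`e ≤ k ↔ e * k = e`, even if the ring is ordered. -/
def Idem (S : Type*) [CommRing S] : Type _ := {e : S // IsIdempotentElem e}

/-- The Boolean algebra of idempotents: `e ⊓ k = e * k`, `e ⊔ k = e + k - e * k`, `eᶜ = 1 - e`. -/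
instance (S : Type*) [CommRing S] : BooleanAlgebra (Idem S) :=
  inferInstanceAs (BooleanAlgebra {e : S // IsIdempotentElem e})

/-- An idempotent as an element of the ring. -/
def Idem.val {S : Type*} [CommRing S] (e : Idem S) : S := Subtype.val e

/-- The restriction of a relation to the idempotents. -/
def idemRel {S : Type*} [CommRing S] (prec : S → S → Prop) : Idem S → Idem S → Prop :=
  fun e k => prec e.val k.val

section Algebras

variable (A S : Type*) [CommRing A] [LinearOrder A] [CommRing S] [Algebra A S]

/-- Specker algebras: generated by a Boolean algebra of idempotents whose nonzero elements are
faithful. -/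
def IsSpecker : Prop :=
  ∃ B : BooleanSubalgebra (Idem S),
    (∀ e ∈ B, e ≠ ⊥ → ∀ a : A, a • e.val = 0 → a = 0) ∧
      Algebra.adjoin A (Idem.val '' (B : Set (Idem S))) = ⊤

/-- Torsion-free `f`-algebras over `A`. -/
structure IsTorsionFreeFAlgebra [Lattice S] : Prop where
  add_le_add_right : ∀ s t r : S, s ≤ t → s + r ≤ t + r
  mul_nonneg : ∀ s t : S, 0 ≤ s → 0 ≤ t → 0 ≤ s * t
  smul_nonneg : ∀ (a : A) (s : S), 0 ≤ a → 0 ≤ s → 0 ≤ a • s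
  mul_inf_eq_zero : ∀ s t r : S, s ⊓ t = 0 → 0 ≤ r → (s * r) ⊓ t = 0
  torsion_free : ∀ (a : A) (s : S), a • s = 0 → a = 0 ∨ s = 0

variable {S} in
/-- Proximities on torsion-free `f`-algebras. -/
structure IsProximity [Lattice S] (prec : S → S → Prop) : Prop where
  zero : prec 0 0
  one : prec 1 1
  le : ∀ s t, prec s t → s ≤ t
  mono : ∀ s t r u, s ≤ t → prec t r → r ≤ u → prec s u
  inf : ∀ s t r, prec s t → prec s r → prec s (t ⊓ r)
  neg : ∀ s t, prec s t → prec (-t) (-s)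
  add : ∀ s t r u, prec s t → prec r u → prec (s + r) (t + u)
  smul : ∀ s t, ∀ a : A, 0 < a → prec s t → prec (a • s) (a • t)
  of_smul : ∀ s t, ∀ a : A, 0 < a → prec (a • s) (a • t) → prec s t
  mul : ∀ s t r u, 0 ≤ s → 0 ≤ t → 0 ≤ r → 0 ≤ u → prec s t → prec r u → prec (s * r) (t * u)
  interpolate : ∀ s t, prec s t → ∃ r, prec s r ∧ prec r t
  exists_pos : ∀ s, 0 < s → ∃ t, 0 < t ∧ prec t s

variable {S} in
/-- Proximity Specker algebras `(S, ≺)` over `A`. -/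
structure IsProximitySpecker [Lattice S] (prec : S → S → Prop) : Prop where
  fAlgebra : IsTorsionFreeFAlgebra A S
  specker : IsSpecker A S
  proximity : IsProximity A prec

/-- Baer rings: the annihilator of every subset is generated by an idempotent. -/
def IsBaer (S : Type*) [CommRing S] : Prop :=
  ∀ M : Set S, ∃ e : S, IsIdempotentElem e ∧ {s : S | ∀ m ∈ M, s * m = 0} = Ideal.span {e}

variable {S} in
/-- The expression `a₀ + ∑ bᵢ eᵢ` is in decreasing form, that is, all `bᵢ` are positive and
`1 > e₁ > ⋯ > eₙ > 0`. -/
structure IsDecreasingForm {n : ℕ} (b : Fin n → A) (e : Fin n → Idem S) : Prop where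
  pos : ∀ i, 0 < b i
  lt_top : ∀ i, e i < ⊤
  strictAnti : StrictAnti e
  bot_lt : ∀ i, ⊥ < e i

variable {S} {T : Type*} [CommRing T] [Algebra A T]

/-- Proximity morphisms. -/
structure IsProximityMorphism [Lattice S] [Lattice T] (precS : S → S → Prop)
    (precT : T → T → Prop) (α : S → T) : Prop where
  map_zero : α 0 = 0
  map_inf : ∀ s t, α (s ⊓ t) = α s ⊓ α t
  map_prec : ∀ s t, precS s t → precT (-α (-s)) (α t)
  isLUB : ∀ s, IsLUB (α '' {t | precS t s}) (α s)
  map_add : ∀ (s : S) (a : A), α (s + algebraMap A S a) = α s + algebraMap A T a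
  map_smul : ∀ (s : S) (a : A), 0 < a → α (a • s) = a • α s
  map_sup : ∀ (s : S) (a : A), α (s ⊔ algebraMap A S a) = α s ⊔ algebraMap A T a

/-- `η` is the canonical embedding of `(S, ≺)` into the normal functions on the space of ends of
the idempotents of `S`: the homomorphism of `A`-algebras that sends each idempotent `e` to the
characteristic function of `zeta e` (there is at most one, as the idempotents generate `S`). It
preserves the lattice operations, is injective, preserves and reflects the proximity, and has a
dense image. -/
structure IsCanonicalEmbedding [Lattice S] (prec : S → S → Prop)
    (η : S →ₐ[A] FN (EndSpace (idemRel prec)) A) : Prop where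
  map_idem : ∀ e : Idem S, ⇑(η e.val) = (zeta (idemRel prec) e).indicator 1
  map_inf : ∀ s t, η (s ⊓ t) = η s ⊓ η t
  map_sup : ∀ s t, η (s ⊔ t) = η s ⊔ η t
  injective : Function.Injective η
  prec_iff : ∀ s t, prec s t ↔ (η s).prec (η t)
  dense : ∀ f g : FN (EndSpace (idemRel prec)) A, f.prec g → ∃ s, f.prec (η s) ∧ (η s).prec g

end Algebras

end

end DeVriesPower

open DeVriesPower

namespace DeVriesPower

/-! Two representations carry the theorem. The first is de Vries duality. The idempotents of a
proximity Specker algebra form a compingent algebra (`IsProximitySpecker.isCompingent`). Its ends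
form a compact Hausdorff space with the regular open sets `zeta e` as a basis, and `e ≺ k` means
that the closure of `zeta e` lies in `zeta k`. A de Vries morphism `σ` yields a continuous `φ` for
which `zeta (σ e)` is the interior of the closure of `φ⁻¹(zeta e)` (`IsDeVriesMorphism.zeta_map`).

The second is the map `η`. Some finite partition of unity into idempotents makes an element `s` a
scalar on each piece. So `s` has values at a dense open set of ends, unambiguous by
torsion-freeness, and a normal function is determined by its values on a dense set. This uniqueness
(`Represents.unique`) forces `η` to preserve all operations. Each set `{c ≤ η s}` is `zeta l` for an
idempotent `l`, which reduces order and proximity to idempotents.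

For morphisms the link is truncation. If no value of `η s` lies strictly between `c'` and `c`, then
`(s ⊔ c') ⊓ c = c' + (c - c') l`. A proximity morphism respects every operation in this identity, so
it is determined level by level by its restriction to idempotents, and it is `φ^*` for the dual `φ`
(`IsProximityMorphism.eq_pullback`). Conversely `φ^*` acts on level sets by interior-closure of
preimages. Hence it commutes with meets and with monotone maps of `A`, and it is additive along
decreasing forms, where the summands are comonotone and sums are pointwise. When the idempotents of
`T` form a complete Boolean algebra, every regular open set is some `zeta e`, so every `φ` arises.
-/

theorem interior_closure_inter {X : Type*} [TopologicalSpace X] {U V : Set X} (hU : IsOpen U) :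
    interior (closure (U ∩ V)) = interior (closure U) ∩ interior (closure V) := by
  refine Subset.antisymm ?_ ?_
  · rw [← interior_inter]
    exact interior_mono (closure_inter_subset_inter_closure U V)
  · refine interior_maximal ?_ (isOpen_interior.inter isOpen_interior)
    refine (inter_subset_inter_left _ interior_subset).trans
      (isOpen_interior.closure_inter.trans (closure_minimal ?_ isClosed_closure))
    exact (inter_subset_inter_right _ interior_subset).trans hU.inter_closure

/-! ### Compingent algebras and their spaces of ends. -/

section Compingent

variable {B C : Type*} [BooleanAlgebra B] [BooleanAlgebra C]

/-- Proximities on a Boolean algebra that make it a compingent algebra. -/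
structure IsCompingent (prec : B → B → Prop) : Prop where
  bot : prec ⊥ ⊥
  le : ∀ {a b}, prec a b → a ≤ b
  mono : ∀ {a b c d}, a ≤ b → prec b c → c ≤ d → prec a d
  inf : ∀ {a b c}, prec a b → prec a c → prec a (b ⊓ c)
  compl : ∀ {a b}, prec a b → prec bᶜ aᶜ
  interpolate : ∀ {a b}, prec a b → ∃ c, prec a c ∧ prec c b
  exists_prec : ∀ {a}, a ≠ ⊥ → ∃ b, b ≠ ⊥ ∧ prec b a

namespace IsCompingent

variable {prec : B → B → Prop} (h : IsCompingent prec)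
include h

theorem compl_iff {a b : B} : prec bᶜ aᶜ ↔ prec a b :=
  ⟨fun hab => by simpa using h.compl hab, h.compl⟩

theorem sup {a b c : B} (hac : prec a c) (hbc : prec b c) : prec (a ⊔ b) c := by
  rw [← h.compl_iff, compl_sup]
  exact h.inf (h.compl hac) (h.compl hbc)

theorem sup_sup {a b c d : B} (hab : prec a b) (hcd : prec c d) : prec (a ⊔ c) (b ⊔ d) :=
  h.sup (h.mono le_rfl hab le_sup_left) (h.mono le_rfl hcd le_sup_right)

/-- The elements proximal to an element of an ideal form a round ideal. -/
def roundPart (I : Order.Ideal B) : Order.Ideal B :=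
  Order.IsIdeal.toIdeal (I := {a | ∃ b ∈ I, prec a b})
    { IsLowerSet := fun _ _ hba ⟨c, hc, hac⟩ => ⟨c, hc, h.mono hba hac le_rfl⟩
      Nonempty := ⟨⊥, ⊥, I.bot_mem, h.bot⟩
      Directed := fun a ⟨c, hc, hac⟩ b ⟨d, hd, hbd⟩ =>
        ⟨a ⊔ b, ⟨c ⊔ d, Order.Ideal.sup_mem hc hd, h.sup_sup hac hbd⟩, le_sup_left,
          le_sup_right⟩ }

theorem isRound_roundPart (I : Order.Ideal B) : IsRound prec (h.roundPart I) := by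
  ext a
  constructor
  · rintro ⟨b, hb, hab⟩
    obtain ⟨c, hac, hcb⟩ := h.interpolate hab
    exact ⟨c, ⟨b, hb, hcb⟩, hac⟩
  · rintro ⟨b, hb, hab⟩
    exact (h.roundPart I).lower (h.le hab) hb

/-- Let `J` be a larger proper round ideal and `a ≺ c ≺ d ≺ b` with `b ∈ J`. Either `c ∈ I`, which
puts `a` in the round part, or `dᶜ ∈ I`, which puts `bᶜ` in `J` next to `b`. -/
theorem maximal_roundPart {I : Order.Ideal B} (hI : ⊤ ∉ I)
    (hmem : ∀ a b, prec a b → a ∈ I ∨ bᶜ ∈ I) :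
    Maximal (fun J : Order.Ideal B => IsRound prec J ∧ J.IsProper) (h.roundPart I) := by
  refine ⟨⟨h.isRound_roundPart I, ?_⟩, ?_⟩
  · rw [Order.Ideal.isProper_iff_top_notMem]
    rintro ⟨b, hb, htb⟩
    exact hI (top_le_iff.1 (h.le htb) ▸ hb)
  · rintro J ⟨hJr, hJp⟩ hIJ a ha
    have ha' : a ∈ (J : Set B) := ha
    rw [hJr] at ha'
    obtain ⟨b, hb, hab⟩ := ha'
    obtain ⟨c, hac, hcb⟩ := h.interpolate hab
    obtain ⟨d, hcd, hdb⟩ := h.interpolate hcb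
    rcases hmem c d hcd with hc | hd
    · exact ⟨c, hc, hac⟩
    · exact (hJp.notMem_of_compl_mem (hIJ ⟨dᶜ, hd, h.compl hdb⟩) hb).elim

/-- The end obtained from a proper ideal that contains `a` or `bᶜ` whenever `a ≺ b`. -/
def toEnd (I : Order.Ideal B) (hI : ⊤ ∉ I) (hmem : ∀ a b, prec a b → a ∈ I ∨ bᶜ ∈ I) :
    EndSpace prec :=
  ⟨h.roundPart I, h.maximal_roundPart hI hmem⟩

theorem exists_end (I : Order.Ideal B) (hI : ⊤ ∉ I) :
    ∃ P : Order.Ideal B, P.IsPrime ∧ I ≤ P ∧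
      Maximal (fun J : Order.Ideal B => IsRound prec J ∧ J.IsProper) (h.roundPart P) := by
  obtain ⟨P, hIP, hP⟩ := (Order.Ideal.isProper_iff_top_notMem.2 hI).exists_le_maximal
  have hprime : P.IsPrime := inferInstance
  refine ⟨P, hprime, hIP, h.maximal_roundPart
    (Order.Ideal.isProper_iff_top_notMem.1 hP.toIsProper) fun a b hab => ?_⟩
  rcases hprime.mem_or_compl_mem (x := b) with hb | hb
  · exact Or.inl (P.lower (h.le hab) hb)
  · exact Or.inr hb

omit h in
theorem exists_prec_mem (x : EndSpace prec) {a : B} (ha : a ∈ x.1) : ∃ b ∈ x.1, prec a b := by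
  have ha' : a ∈ (x.1 : Set B) := ha
  rw [x.2.1.1] at ha'
  exact ha'

omit h in
theorem top_notMem (x : EndSpace prec) : ⊤ ∉ x.1 :=
  Order.Ideal.isProper_iff_top_notMem.1 x.2.1.2

/-- By maximality an end is the round part of any prime ideal containing it. The prime ideal decides
an element interpolated between `a` and `b`. -/
theorem mem_or_compl_mem (x : EndSpace prec) {a b : B} (hab : prec a b) :
    a ∈ x.1 ∨ bᶜ ∈ x.1 := by
  obtain ⟨P, hP, hxP, hmax⟩ := h.exists_end x.1 (top_notMem x)
  have hle : x.1 ≤ h.roundPart P := fun c hc => by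
    obtain ⟨d, hd, hcd⟩ := exists_prec_mem x hc
    exact ⟨d, hxP hd, hcd⟩
  have hge : h.roundPart P ≤ x.1 := x.2.2 hmax.1 hle
  obtain ⟨c, hac, hcb⟩ := h.interpolate hab
  rcases hP.mem_or_compl_mem (x := c) with hc | hc
  · exact Or.inl (hge ⟨c, hc, hac⟩)
  · exact Or.inr (hge ⟨cᶜ, hc, h.compl hcb⟩)

omit h in
theorem mem_zeta {x : EndSpace prec} {a : B} : x ∈ zeta prec a ↔ aᶜ ∈ x.1 := Iff.rfl

omit h in
theorem mem_zeta_compl {x : EndSpace prec} {a : B} : x ∈ zeta prec aᶜ ↔ a ∈ x.1 := by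
  rw [mem_zeta, compl_compl]

omit h in
theorem zeta_inf (a b : B) : zeta prec (a ⊓ b) = zeta prec a ∩ zeta prec b := by
  ext x
  rw [mem_zeta, compl_inf, Order.Ideal.sup_mem_iff]
  rfl

omit h in
theorem zeta_mono {a b : B} (hab : a ≤ b) : zeta prec a ⊆ zeta prec b := fun x hx =>
  x.1.lower (compl_le_compl hab) hx

omit h in
theorem zeta_top : zeta prec (⊤ : B) = univ := by
  ext x
  simp [mem_zeta]

omit h in
theorem zeta_bot : zeta prec (⊥ : B) = ∅ := by
  ext x
  simpa [mem_zeta] using top_notMem x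

omit h in
theorem disjoint_zeta_compl (a : B) : Disjoint (zeta prec a) (zeta prec aᶜ) := by
  rw [disjoint_iff_inter_eq_empty, ← zeta_inf, inf_compl_self, zeta_bot]

theorem zeta_nonempty {a : B} (ha : a ≠ ⊥) : (zeta prec a).Nonempty := by
  obtain ⟨b, hb, hba⟩ := h.exists_prec ha
  have hI : ⊤ ∉ Order.Ideal.principal bᶜ := by
    rw [Order.Ideal.mem_principal, top_le_iff, compl_eq_top]; exact hb
  obtain ⟨P, -, hIP, hmax⟩ := h.exists_end _ hI
  exact ⟨⟨_, hmax⟩, bᶜ, hIP Order.Ideal.mem_principal_self, h.compl hba⟩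

theorem zeta_eq_empty {a : B} : zeta prec a = ∅ ↔ a = ⊥ := by
  refine ⟨fun ha => ?_, fun ha => ha ▸ zeta_bot⟩
  by_contra hne
  exact (h.zeta_nonempty hne).ne_empty ha

theorem zeta_subset_iff {a b : B} : zeta prec a ⊆ zeta prec b ↔ a ≤ b := by
  refine ⟨fun hab => ?_, zeta_mono⟩
  rw [← disjoint_compl_right_iff, disjoint_iff, ← h.zeta_eq_empty, zeta_inf,
    ← disjoint_iff_inter_eq_empty]
  exact (disjoint_zeta_compl b).mono_left hab

theorem zeta_injective : Function.Injective (zeta prec) := fun _ _ hab =>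
  le_antisymm (h.zeta_subset_iff.1 hab.subset) (h.zeta_subset_iff.1 hab.superset)

omit h in
theorem isTopologicalBasis : TopologicalSpace.IsTopologicalBasis (range (zeta prec)) where
  exists_subset_inter := by
    rintro _ ⟨a, rfl⟩ _ ⟨b, rfl⟩ x hx
    exact ⟨zeta prec (a ⊓ b), mem_range_self _, by rwa [zeta_inf], by rw [zeta_inf]⟩
  sUnion_eq := eq_univ_of_univ_subset
    (zeta_top (prec := prec) ▸ subset_sUnion_of_mem (mem_range_self ⊤))
  eq_generateFrom := by
    have : range (zeta prec) = range fun a : B => {x : EndSpace prec | a ∈ x.1} := by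
      ext s
      constructor
      · rintro ⟨a, rfl⟩
        exact ⟨aᶜ, rfl⟩
      · rintro ⟨a, rfl⟩
        exact ⟨aᶜ, by ext x; exact mem_zeta_compl⟩
    rw [this]
    rfl

omit h in
theorem isOpen_zeta (a : B) : IsOpen (zeta prec a) :=
  isTopologicalBasis.isOpen (mem_range_self a)

omit h in
theorem exists_zeta_subset {V : Set (EndSpace prec)} (hV : IsOpen V) {x : EndSpace prec}
    (hx : x ∈ V) : ∃ a, x ∈ zeta prec a ∧ zeta prec a ⊆ V := by
  obtain ⟨_, ⟨a, rfl⟩, hxa, haV⟩ := isTopologicalBasis.exists_subset_of_mem_open hx hV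
  exact ⟨a, hxa, haV⟩

omit h in
theorem exists_nonbot_zeta_subset {V : Set (EndSpace prec)} (hV : IsOpen V) (hne : V.Nonempty) :
    ∃ a ≠ ⊥, zeta prec a ⊆ V := by
  obtain ⟨x, hx⟩ := hne
  obtain ⟨a, hxa, haV⟩ := exists_zeta_subset hV hx
  refine ⟨a, ?_, haV⟩
  rintro rfl
  rw [zeta_bot] at hxa
  exact hxa

theorem compl_zeta_compl_subset {a b : B} (hab : prec a b) :
    (zeta prec aᶜ)ᶜ ⊆ zeta prec b := fun x hx =>
  (h.mem_or_compl_mem x hab).resolve_left fun ha => hx (mem_zeta_compl.2 ha)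

omit h in
theorem closure_zeta_subset_compl (a : B) : closure (zeta prec a) ⊆ (zeta prec aᶜ)ᶜ :=
  closure_minimal (disjoint_zeta_compl a).subset_compl_right (isOpen_zeta _).isClosed_compl

theorem exists_prec_mem_zeta {a : B} {x : EndSpace prec} (hx : x ∈ zeta prec a) :
    ∃ b, prec b a ∧ x ∈ zeta prec b := by
  obtain ⟨b, hb, hab⟩ := exists_prec_mem x hx
  exact ⟨bᶜ, by rwa [← h.compl_iff, compl_compl], mem_zeta_compl.2 hb⟩

/-- A basic set `zeta b` inside `V` misses `zeta aᶜ`, so `b ⊓ aᶜ = ⊥`. Thus `zeta a` is the largest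
open set disjoint from `zeta aᶜ`, which makes it regular open. -/
theorem isOpen_subset_zeta_of_disjoint {V : Set (EndSpace prec)} (hV : IsOpen V) {a : B}
    (hVa : Disjoint V (zeta prec aᶜ)) : V ⊆ zeta prec a := by
  intro x hx
  obtain ⟨b, hxb, hbV⟩ := exists_zeta_subset hV hx
  refine zeta_mono ?_ hxb
  rw [← disjoint_compl_right_iff, disjoint_iff, ← h.zeta_eq_empty, zeta_inf,
    ← disjoint_iff_inter_eq_empty]
  exact hVa.mono_left hbV

theorem interior_closure_zeta (a : B) :
    interior (closure (zeta prec a)) = zeta prec a := by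
  refine Subset.antisymm (h.isOpen_subset_zeta_of_disjoint isOpen_interior ?_)
    (isOpen_zeta a).subset_interior_closure
  exact (subset_compl_iff_disjoint_right.1 (closure_zeta_subset_compl a)).mono_left
    interior_subset

theorem compactSpace : CompactSpace (EndSpace prec) := by
  refine ⟨isCompact_iff_ultrafilter_le_nhds.2 fun U _ => ?_⟩
  -- The limit of `U` is the round part of this ideal. If `a ≺ b`, the sets `zeta aᶜ` and `zeta b`
  -- cover the space, so `U` contains one of them; this is the condition for the round part to be an
  -- end.
  let I : Order.Ideal B := Order.IsIdeal.toIdeal (I := {a | zeta prec aᶜ ∈ U})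
    { IsLowerSet := fun a b hba ha => mem_of_superset ha (zeta_mono (compl_le_compl hba))
      Nonempty := ⟨⊥, by
        show zeta prec ⊥ᶜ ∈ U
        rw [compl_bot, zeta_top]
        exact univ_mem⟩
      Directed := fun a ha b hb => ⟨a ⊔ b, by
        have : zeta prec aᶜ ∩ zeta prec bᶜ ∈ U := inter_mem ha hb
        simpa [compl_sup, zeta_inf] using this, le_sup_left, le_sup_right⟩ }
  have hI : ∀ a, a ∈ I ↔ zeta prec aᶜ ∈ U := fun a => Iff.rfl
  refine ⟨h.toEnd I (by simp [hI, zeta_bot]) fun a b hab => ?_, mem_univ _, ?_⟩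
  · rw [hI, hI, compl_compl]
    by_contra! hcon
    exact hcon.2 (mem_of_superset (Ultrafilter.compl_mem_iff_notMem.2 hcon.1)
      (h.compl_zeta_compl_subset hab))
  · intro V hV
    obtain ⟨W, hWV, hW, hxW⟩ := mem_nhds_iff.1 hV
    obtain ⟨a, hxa, haW⟩ := exists_zeta_subset hW hxW
    obtain ⟨b, hb, hab⟩ := hxa
    refine mem_of_superset ((hI b).1 hb) (Subset.trans (zeta_mono ?_) (haW.trans hWV))
    exact compl_le_iff_compl_le.1 (h.le hab)

theorem t2Space : T2Space (EndSpace prec) := by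
  refine ⟨fun x y hxy => ?_⟩
  have : ¬ x.1 ≤ y.1 := fun hle =>
    hxy (Subtype.ext (le_antisymm hle (x.2.2 y.2.1 hle)))
  obtain ⟨a, hax, hay⟩ := Set.not_subset.1 this
  obtain ⟨b, hbx, hab⟩ := exists_prec_mem x hax
  exact ⟨zeta prec bᶜ, zeta prec b, isOpen_zeta _, isOpen_zeta _, mem_zeta_compl.2 hbx,
    (h.mem_or_compl_mem y hab).resolve_left hay, (disjoint_zeta_compl b).symm⟩

theorem exists_between {K V : Set (EndSpace prec)} (hK : IsClosed K) (hV : IsOpen V)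
    (hKV : K ⊆ V) : ∃ a, K ⊆ zeta prec a ∧ (zeta prec aᶜ)ᶜ ⊆ V := by
  have := h.compactSpace
  refine hK.isCompact.induction_on (p := fun s => ∃ a, s ⊆ zeta prec a ∧ (zeta prec aᶜ)ᶜ ⊆ V)
    ⟨⊥, empty_subset _, by simp [zeta_top]⟩ ?_ ?_ ?_
  · rintro s t hst ⟨a, hta, haV⟩
    exact ⟨a, hst.trans hta, haV⟩
  · rintro s t ⟨a, hsa, haV⟩ ⟨b, htb, hbV⟩
    refine ⟨a ⊔ b, union_subset (hsa.trans (zeta_mono le_sup_left))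
      (htb.trans (zeta_mono le_sup_right)), ?_⟩
    rw [compl_sup, zeta_inf, compl_inter]
    exact union_subset haV hbV
  · intro x hx
    obtain ⟨a, hxa, haV⟩ := exists_zeta_subset hV (hKV hx)
    obtain ⟨b, hba, hxb⟩ := h.exists_prec_mem_zeta hxa
    exact ⟨zeta prec b, mem_nhdsWithin_of_mem_nhds ((isOpen_zeta b).mem_nhds hxb), b, Subset.rfl,
      (h.compl_zeta_compl_subset hba).trans haV⟩

theorem exists_prec_between {K : Set (EndSpace prec)} (hK : IsClosed K) {b : B}
    (hKb : K ⊆ zeta prec b) : ∃ a, K ⊆ zeta prec a ∧ prec a b := by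
  have := h.compactSpace
  refine hK.isCompact.induction_on (p := fun s => ∃ a, s ⊆ zeta prec a ∧ prec a b)
    ⟨⊥, empty_subset _, h.mono le_rfl h.bot bot_le⟩ ?_ ?_ ?_
  · rintro s t hst ⟨a, hta, hab⟩
    exact ⟨a, hst.trans hta, hab⟩
  · rintro s t ⟨a, hsa, hab⟩ ⟨c, htc, hcb⟩
    exact ⟨a ⊔ c, union_subset (hsa.trans (zeta_mono le_sup_left))
      (htc.trans (zeta_mono le_sup_right)), h.sup hab hcb⟩
  · intro x hx
    obtain ⟨a, hab, hxa⟩ := h.exists_prec_mem_zeta (hKb hx)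
    exact ⟨zeta prec a, mem_nhdsWithin_of_mem_nhds ((isOpen_zeta a).mem_nhds hxa), a, Subset.rfl,
      hab⟩

/-- For the converse, compactness covers the closure of `zeta a` by finitely many `zeta c` with `c ≺
b`, and the join of these `c` is still proximal to `b`. -/
theorem prec_iff_closure {a b : B} : prec a b ↔ closure (zeta prec a) ⊆ zeta prec b := by
  refine ⟨fun hab => (closure_zeta_subset_compl a).trans (h.compl_zeta_compl_subset hab),
    fun hab => ?_⟩
  obtain ⟨c, hac, hcb⟩ := h.exists_prec_between isClosed_closure hab
  exact h.mono (h.zeta_subset_iff.1 (subset_closure.trans hac)) hcb le_rfl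

/-- Otherwise some nonzero `d ≤ a` has `zeta d` disjoint from every `zeta m`. Then `dᶜ` is an upper
bound of `M`, so `d ≤ a ≤ dᶜ`, which is absurd. -/
theorem zeta_subset_closure_of_isLUB {M : Set B} {a : B} (ha : IsLUB M a) :
    zeta prec a ⊆ closure (⋃ m ∈ M, zeta prec m) := by
  intro x hx
  by_contra hcon
  obtain ⟨d, hd, hsub⟩ := exists_nonbot_zeta_subset (prec := prec)
    ((isOpen_zeta a).inter isClosed_closure.isOpen_compl) ⟨x, hx, hcon⟩
  have hda : d ≤ a := h.zeta_subset_iff.1 (hsub.trans inter_subset_left)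
  have hub : a ≤ dᶜ := ha.2 fun m hm => by
    rw [← disjoint_compl_right_iff, compl_compl, disjoint_iff, ← h.zeta_eq_empty, zeta_inf,
      ← disjoint_iff_inter_eq_empty, Set.disjoint_left]
    intro y hym hyd
    exact (hsub hyd).2 (subset_closure (mem_iUnion₂.2 ⟨m, hm, hym⟩))
  exact hd (le_compl_self.1 (hda.trans hub))

/-- In a complete Boolean algebra every regular open set of ends is basic. -/
theorem exists_zeta_eq (hB : ∀ M : Set B, ∃ a, IsLUB M a) {U : Set (EndSpace prec)}
    (hU : interior (closure U) = U) : ∃ a, zeta prec a = U := by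
  obtain ⟨a, ha⟩ := hB {c | zeta prec c ⊆ U}
  have hUo : IsOpen U := hU ▸ isOpen_interior
  refine ⟨a, Subset.antisymm ?_ fun x hx => ?_⟩
  · rw [← hU]
    refine interior_maximal ((h.zeta_subset_closure_of_isLUB ha).trans
      (closure_mono (iUnion₂_subset fun c hc => hc))) (isOpen_zeta a)
  · obtain ⟨c, hxc, hcU⟩ := exists_zeta_subset hUo hx
    exact zeta_mono (ha.1 hcU) hxc

end IsCompingent

/-! ### Duality between de Vries morphisms and continuous maps of ends. -/

section Dual

variable {precB : B → B → Prop} {precC : C → C → Prop}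
  (hB : IsCompingent precB) (hC : IsCompingent precC)

open IsCompingent

theorem IsDeVriesMorphism.mono {σ : B → C} (hσ : IsDeVriesMorphism precB precC σ) : Monotone σ :=
  fun a b hab => by
    have := hσ.map_inf a b
    rw [inf_eq_left.2 hab] at this
    rw [this]
    exact inf_le_right

include hB hC

theorem IsDeVriesMorphism.map_top {σ : B → C} (hσ : IsDeVriesMorphism precB precC σ) :
    σ ⊤ = ⊤ := by
  have := hC.le (hσ.map_prec _ _ hB.bot)
  rw [compl_bot, hσ.map_bot, le_bot_iff, compl_eq_bot] at this
  exact this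

/-- The ideal `{c | ¬σ(¬c) ∈ x}`, for a de Vries morphism `σ` and an end `x`. -/
def IsDeVriesMorphism.comapIdeal {σ : B → C} (hσ : IsDeVriesMorphism precB precC σ)
    (x : EndSpace precC) : Order.Ideal B :=
  Order.IsIdeal.toIdeal (I := {c | x ∈ zeta precC (σ cᶜ)})
    { IsLowerSet := fun _ _ hba ha => zeta_mono (hσ.mono (compl_le_compl hba)) ha
      Nonempty := ⟨⊥, by simp [hσ.map_top hB hC, zeta_top]⟩
      Directed := fun a ha b hb => ⟨a ⊔ b, by
        have : x ∈ zeta precC (σ aᶜ) ∩ zeta precC (σ bᶜ) := ⟨ha, hb⟩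
        simpa [compl_sup, hσ.map_inf, zeta_inf] using this, le_sup_left, le_sup_right⟩ }

theorem IsDeVriesMorphism.mem_comapIdeal {σ : B → C} (hσ : IsDeVriesMorphism precB precC σ)
    {x : EndSpace precC} {c : B} :
    c ∈ hσ.comapIdeal hB hC x ↔ x ∈ zeta precC (σ cᶜ) := Iff.rfl

/-- The map on ends induced by a de Vries morphism. -/
def IsDeVriesMorphism.endMap {σ : B → C} (hσ : IsDeVriesMorphism precB precC σ)
    (x : EndSpace precC) : EndSpace precB :=
  hB.toEnd (hσ.comapIdeal hB hC x)
    (by rw [hσ.mem_comapIdeal, compl_top, hσ.map_bot, zeta_bot]; exact fun hx => hx)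
    fun a b hab => by
      rw [hσ.mem_comapIdeal, hσ.mem_comapIdeal, compl_compl]
      by_contra! hcon
      exact hcon.2 (hC.compl_zeta_compl_subset (hσ.map_prec a b hab)
        (by rw [compl_compl]; exact hcon.1))

/-- The union over `k ≺ e` comes from taking the round part of the pulled back ideal, which need not
itself be round. -/
theorem IsDeVriesMorphism.preimage_endMap {σ : B → C} (hσ : IsDeVriesMorphism precB precC σ)
    (e : B) : hσ.endMap hB hC ⁻¹' zeta precB e = ⋃ k ∈ {k | precB k e}, zeta precC (σ k) := by
  ext x
  simp only [mem_iUnion₂, mem_ofPred_eq, exists_prop]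
  constructor
  · rintro ⟨c, hc, hec⟩
    exact ⟨cᶜ, by rwa [← hB.compl_iff, compl_compl], hc⟩
  · rintro ⟨k, hke, hx⟩
    exact ⟨kᶜ, by rwa [hσ.mem_comapIdeal, compl_compl], hB.compl hke⟩

theorem IsDeVriesMorphism.continuous_endMap {σ : B → C} (hσ : IsDeVriesMorphism precB precC σ) :
    Continuous (hσ.endMap hB hC) := by
  rw [isTopologicalBasis.continuous_iff]
  rintro _ ⟨e, rfl⟩
  rw [hσ.preimage_endMap hB hC]
  exact isOpen_biUnion fun k _ => isOpen_zeta _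

/-- The least upper bound axiom says precisely that the union computed in `preimage_endMap` is dense
in `zeta (σ e)`. -/
theorem IsDeVriesMorphism.zeta_map {σ : B → C} (hσ : IsDeVriesMorphism precB precC σ) (e : B) :
    zeta precC (σ e) = interior (closure (hσ.endMap hB hC ⁻¹' zeta precB e)) := by
  rw [hσ.preimage_endMap hB hC]
  refine Subset.antisymm (interior_maximal ?_ (isOpen_zeta _)) ?_
  · have := hC.zeta_subset_closure_of_isLUB (hσ.isLUB e)
    rwa [biUnion_image] at this
  · rw [← hC.interior_closure_zeta (σ e)]
    exact interior_mono (closure_mono (iUnion₂_subset fun k hk =>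
      zeta_mono (hσ.mono (hB.le hk))))

theorem isDeVriesMorphism_of_zeta {σ : B → C} (φ : C(EndSpace precC, EndSpace precB))
    (hφ : ∀ e, zeta precC (σ e) = interior (closure (φ ⁻¹' zeta precB e))) :
    IsDeVriesMorphism precB precC σ := by
  have hopen : ∀ e, IsOpen (φ ⁻¹' zeta precB e) := fun e => (isOpen_zeta e).preimage φ.continuous
  have hsub : ∀ e, φ ⁻¹' zeta precB e ⊆ zeta precC (σ e) := fun e => by
    rw [hφ]; exact (hopen e).subset_interior_closure
  have hmono : ∀ a b, a ≤ b → σ a ≤ σ b := fun a b hab => by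
    rw [← hC.zeta_subset_iff, hφ, hφ]
    exact interior_mono (closure_mono (preimage_mono (zeta_mono hab)))
  refine ⟨?_, fun a b => ?_, fun a b hab => ?_, fun a => ⟨?_, fun u hu => ?_⟩⟩
  · rw [← hC.zeta_eq_empty, hφ, zeta_bot]; simp
  · refine le_antisymm (le_inf (hmono _ _ inf_le_left) (hmono _ _ inf_le_right)) ?_
    rw [← hC.zeta_subset_iff, zeta_inf, hφ, hφ, hφ, zeta_inf, preimage_inter,
      interior_closure_inter (hopen a)]
  · rw [hC.prec_iff_closure]
    -- The preimage of the complement of `zeta aᶜ` is closed, so it contains the closure as well,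
    -- and it lies in the preimage of `zeta b` because `a ≺ b`.
    have h1 : zeta precC (σ aᶜ)ᶜ ⊆ φ ⁻¹' (zeta precB aᶜ)ᶜ := fun x hx hxa =>
      (disjoint_zeta_compl _).ne_of_mem (hsub _ hxa) hx rfl
    exact (closure_minimal h1 ((isOpen_zeta _).isClosed_compl.preimage φ.continuous)).trans
      ((preimage_mono (hB.compl_zeta_compl_subset hab)).trans (hsub b))
  · rintro _ ⟨k, hk, rfl⟩
    exact hmono _ _ (hB.le hk)
  · rw [← hC.zeta_subset_iff, hφ, ← hC.interior_closure_zeta u]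
    refine interior_mono (closure_mono fun x hx => ?_)
    obtain ⟨k, hka, hxk⟩ := hB.exists_prec_mem_zeta hx
    exact zeta_mono (hu (mem_image_of_mem σ hka)) (hsub k hxk)

omit hC in
-- If `φ x ≠ ψ x`, choose `zeta a` around `φ x` missing a neighbourhood of `ψ x`. Then `x` is in the
-- closure of `ψ⁻¹(zeta a)`, although `ψ` sends a neighbourhood of `x` outside `zeta a`.
theorem eq_of_interior_closure_preimage_eq {X : Type*} [TopologicalSpace X]
    (φ ψ : C(X, EndSpace precB))
    (hφψ : ∀ e, interior (closure (φ ⁻¹' zeta precB e)) = interior (closure (ψ ⁻¹' zeta precB e))) :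
    φ = ψ := by
  have := hB.t2Space
  ext1 x
  by_contra hne
  obtain ⟨U, V, hU, hV, hxU, hxV, hUV⟩ := t2_separation hne
  obtain ⟨a, hxa, haU⟩ := exists_zeta_subset hU hxU
  have hmem : x ∈ closure (ψ ⁻¹' zeta precB a) := by
    refine interior_subset ?_
    rw [← hφψ]
    exact ((isOpen_zeta a).preimage φ.continuous).subset_interior_closure hxa
  obtain ⟨y, hyV, hya⟩ := mem_closure_iff.1 hmem _ (hV.preimage ψ.continuous) hxV
  exact hUV.ne_of_mem (haU hya) hyV rfl

end Dual

end Compingent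

/-! ### Idempotents in torsion-free `f`-algebras. -/

section FAlgebra

variable {A S : Type*} [CommRing A] [LinearOrder A] [CommRing S] [Algebra A S]

namespace Idem

theorem val_injective : Function.Injective (Idem.val : Idem S → S) := Subtype.val_injective

theorem isIdempotentElem (e : Idem S) : e.val * e.val = e.val := e.2

theorem val_bot : (⊥ : Idem S).val = 0 := rfl

theorem val_compl (e : Idem S) : eᶜ.val = 1 - e.val := rfl

theorem val_inf (e k : Idem S) : (e ⊓ k).val = e.val * k.val := rfl

theorem le_iff {e k : Idem S} : e ≤ k ↔ e.val * k.val = e.val := by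
  rw [← inf_eq_left, ← val_injective.eq_iff, val_inf]

theorem val_mul_compl (e : Idem S) : e.val * eᶜ.val = 0 := by
  rw [← val_inf, inf_compl_self, val_bot]

theorem mul_val_add_mul_compl (s : S) (e : Idem S) : s * e.val + s * eᶜ.val = s := by
  rw [val_compl]; ring

end Idem

theorem completeOrthogonalIdempotents_mul {R ι κ : Type*} [CommRing R] [Fintype ι] [Fintype κ]
    {e : ι → R} {k : κ → R} (he : CompleteOrthogonalIdempotents e)
    (hk : CompleteOrthogonalIdempotents k) :
    CompleteOrthogonalIdempotents fun p : ι × κ => e p.1 * k p.2 := by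
  rw [CompleteOrthogonalIdempotents.iff_ortho_complete]
  refine ⟨?_, ?_⟩
  · rintro ⟨i, j⟩ ⟨i', j'⟩ hne
    show e i * k j * (e i' * k j') = 0
    by_cases hi : i = i'
    · have hj : j ≠ j' := fun hj => hne (by rw [hi, hj])
      rw [mul_mul_mul_comm, hk.ortho hj, mul_zero]
    · rw [mul_mul_mul_comm, he.ortho hi, zero_mul]
  · rw [Fintype.sum_prod_type, ← Finset.sum_mul_sum, he.complete, hk.complete, one_mul]

omit [LinearOrder A] in
-- Elements that are scalar on each piece of a finite partition of unity include the generators, and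
-- they are closed under sums and products by passing to a common refinement.
theorem IsSpecker.exists_decomposition (hS : IsSpecker A S) (s : S) :
    ∃ (ι : Type) (_ : Fintype ι) (e : ι → S) (a : ι → A),
      CompleteOrthogonalIdempotents e ∧ ∀ i, s * e i = a i • e i := by
  obtain ⟨B, -, hB⟩ := hS
  have hs : s ∈ Algebra.adjoin A (Idem.val '' (B : Set (Idem S))) := hB ▸ Algebra.mem_top
  induction hs using Algebra.adjoin_induction with
  | mem x hx =>
    obtain ⟨e, -, rfl⟩ := hx
    refine ⟨Fin 2, inferInstance, ![e.val, 1 - e.val], ![1, 0],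
      CompleteOrthogonalIdempotents.of_isIdempotentElem e.2, fun i => ?_⟩
    fin_cases i
    · simpa using e.isIdempotentElem
    · simpa [← Idem.val_compl] using e.val_mul_compl
  | algebraMap r =>
    refine ⟨Unit, inferInstance, fun _ => 1, fun _ => r, ?_, fun i => ?_⟩
    · rw [CompleteOrthogonalIdempotents.unique_iff]
    · rw [Algebra.smul_def]
  | add x y _ _ hx hy =>
    obtain ⟨ι, _, e, a, he, hx⟩ := hx
    obtain ⟨κ, _, k, b, hk, hy⟩ := hy
    refine ⟨ι × κ, inferInstance, _, fun p => a p.1 + b p.2,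
      completeOrthogonalIdempotents_mul he hk, fun p => ?_⟩
    rw [add_mul, ← mul_assoc, hx, mul_left_comm, hy, add_smul, smul_mul_assoc, mul_smul_comm]
  | mul x y _ _ hx hy =>
    obtain ⟨ι, _, e, a, he, hx⟩ := hx
    obtain ⟨κ, _, k, b, hk, hy⟩ := hy
    refine ⟨ι × κ, inferInstance, _, fun p => a p.1 * b p.2,
      completeOrthogonalIdempotents_mul he hk, fun p => ?_⟩
    rw [mul_mul_mul_comm, hx, hy, smul_mul_smul_comm]

omit [LinearOrder A] in
theorem IsSpecker.exists_mul_eq_smul (hS : IsSpecker A S) {s : S} (hs : s ≠ 0) :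
    ∃ (e : Idem S) (a : A), s * e.val = a • e.val ∧ s * e.val ≠ 0 := by
  obtain ⟨ι, _, e, a, he, hse⟩ := hS.exists_decomposition s
  by_contra! hcon
  refine hs ?_
  rw [← mul_one s, ← he.complete, Finset.mul_sum]
  exact Finset.sum_eq_zero fun i _ => hcon ⟨e i, he.idem i⟩ (a i) (hse i)

variable [Lattice S]

namespace IsTorsionFreeFAlgebra

variable (h : IsTorsionFreeFAlgebra A S)
include h

theorem isOrderedAddMonoid : IsOrderedAddMonoid S where
  add_le_add_left s t hst r := h.add_le_add_right s t r hst

theorem mul_self_nonneg (s : S) : 0 ≤ s * s := by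
  have := h.isOrderedAddMonoid
  have h1 : s⁺ * s⁻ = 0 := by
    -- The `f`-ring axiom is applied to each side of `s⁺ ⊓ s⁻ = 0` in turn, until both sides are the
    -- product `s⁺ * s⁻`.
    have h2 := h.mul_inf_eq_zero _ _ s⁻ (posPart_inf_negPart_eq_zero s) (negPart_nonneg s)
    have h3 := h.mul_inf_eq_zero _ _ s⁺ ((inf_comm _ _).trans h2) (posPart_nonneg s)
    rwa [mul_comm s⁻, inf_idem] at h3
  have h4 : s * s = s⁺ * s⁺ + s⁻ * s⁻ := by
    conv_lhs => rw [← posPart_sub_negPart s]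
    linear_combination (-2) * h1
  rw [h4]
  exact add_nonneg (h.mul_nonneg _ _ (posPart_nonneg s) (posPart_nonneg s))
    (h.mul_nonneg _ _ (negPart_nonneg s) (negPart_nonneg s))

theorem isOrderedRing : IsOrderedRing S := by
  have := h.isOrderedAddMonoid
  have : ZeroLEOneClass S := ⟨by simpa using h.mul_self_nonneg 1⟩
  exact IsOrderedRing.of_mul_nonneg h.mul_nonneg

theorem val_nonneg (e : Idem S) : 0 ≤ e.val := e.isIdempotentElem ▸ h.mul_self_nonneg e.val

theorem val_le_one (e : Idem S) : e.val ≤ 1 := by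
  have := h.isOrderedAddMonoid
  have := h.val_nonneg eᶜ
  rwa [Idem.val_compl, sub_nonneg] at this

theorem mul_val_le_mul_val {s t : S} (hst : s ≤ t) (e : Idem S) : s * e.val ≤ t * e.val :=
  have := h.isOrderedRing
  mul_le_mul_of_nonneg_right hst (h.val_nonneg e)

theorem mul_val_le {s : S} (hs : 0 ≤ s) (e : Idem S) : s * e.val ≤ s :=
  have := h.isOrderedRing
  mul_le_of_le_one_right hs (h.val_le_one e)

theorem val_le_val_iff {e k : Idem S} : e.val ≤ k.val ↔ e ≤ k := by
  rw [Idem.le_iff]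
  constructor
  · intro hek
    refine le_antisymm (h.mul_val_le (h.val_nonneg e) k) ?_
    have := h.mul_val_le_mul_val hek e
    rwa [e.isIdempotentElem, mul_comm] at this
  · intro hek
    rw [← hek, mul_comm]
    exact h.mul_val_le (h.val_nonneg k) e

theorem inf_mul {s t r : S} (hr : 0 ≤ r) : (s ⊓ t) * r = s * r ⊓ t * r := by
  have := h.isOrderedAddMonoid
  -- Subtracting the meet makes the two elements disjoint, and the `f`-ring axiom keeps them
  -- disjoint after multiplication by `r`.
  have h1 : (s - s ⊓ t) ⊓ (t - s ⊓ t) = 0 := by rw [← inf_sub, sub_self]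
  have h2 := h.mul_inf_eq_zero _ _ r h1 hr
  have h3 := h.mul_inf_eq_zero _ _ r ((inf_comm _ _).trans h2) hr
  rw [inf_comm, sub_mul, sub_mul, ← inf_sub, sub_eq_zero] at h3
  exact h3.symm

theorem sup_mul {s t r : S} (hr : 0 ≤ r) : (s ⊔ t) * r = s * r ⊔ t * r := by
  have := h.isOrderedAddMonoid
  have h1 := inf_add_sup s t
  have h2 := inf_add_sup (s * r) (t * r)
  rw [← h.inf_mul hr, ← add_mul, ← h1, add_mul] at h2
  exact (add_left_cancel h2).symm

omit [LinearOrder A] [Algebra A S] [Lattice S] h in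
theorem _root_.DeVriesPower.Idem.eq_of_mul_eq {s t : S} (e : Idem S)
    (h1 : s * e.val = t * e.val) (h2 : s * eᶜ.val = t * eᶜ.val) : s = t := by
  rw [← Idem.mul_val_add_mul_compl s e, ← Idem.mul_val_add_mul_compl t e, h1, h2]

theorem val_inf_eq (e k : Idem S) : (e ⊓ k).val = e.val ⊓ k.val := by
  refine Idem.eq_of_mul_eq e ?_ ?_
  · rw [h.inf_mul (h.val_nonneg e), e.isIdempotentElem, Idem.val_inf, mul_right_comm,
      e.isIdempotentElem, mul_comm k.val, inf_eq_right.2 (h.mul_val_le (h.val_nonneg e) k)]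
  · have h0 : (0 : S) ≤ k.val * eᶜ.val := h.mul_nonneg _ _ (h.val_nonneg k) (h.val_nonneg _)
    rw [h.inf_mul (h.val_nonneg eᶜ), e.val_mul_compl, inf_eq_left.2 h0, Idem.val_inf,
      mul_right_comm, e.val_mul_compl, zero_mul]

theorem smul_le_smul_right [IsOrderedRing A] {a b : A} (hab : a ≤ b) {s : S} (hs : 0 ≤ s) :
    a • s ≤ b • s := by
  have := h.isOrderedAddMonoid
  rw [← sub_nonneg, ← sub_smul]
  exact h.smul_nonneg _ _ (sub_nonneg.2 hab) hs

theorem smul_le_smul_left {a : A} (ha : 0 ≤ a) {s t : S} (hst : s ≤ t) : a • s ≤ a • t := by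
  have := h.isOrderedAddMonoid
  rw [← sub_nonneg, ← smul_sub]
  exact h.smul_nonneg _ _ ha (sub_nonneg.2 hst)

theorem smul_inf_smul [IsOrderedRing A] (a b : A) {s : S} (hs : 0 ≤ s) :
    a • s ⊓ b • s = (a ⊓ b) • s := by
  rcases le_total a b with hab | hab
  · rw [inf_eq_left.2 hab, inf_eq_left.2 (h.smul_le_smul_right hab hs)]
  · rw [inf_eq_right.2 hab, inf_eq_right.2 (h.smul_le_smul_right hab hs)]

theorem smul_sup_smul [IsOrderedRing A] (a b : A) {s : S} (hs : 0 ≤ s) :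
    a • s ⊔ b • s = (a ⊔ b) • s := by
  rcases le_total a b with hab | hab
  · rw [sup_eq_right.2 hab, sup_eq_right.2 (h.smul_le_smul_right hab hs)]
  · rw [sup_eq_left.2 hab, sup_eq_left.2 (h.smul_le_smul_right hab hs)]

theorem val_inf_smul_one [IsOrderedRing A] {a : A} (h0 : 0 ≤ a) (h1 : a ≤ 1) (e : Idem S) :
    e.val ⊓ a • (1 : S) = a • e.val := by
  refine Idem.eq_of_mul_eq e ?_ ?_
  · rw [h.inf_mul (h.val_nonneg e), e.isIdempotentElem, smul_mul_assoc, one_mul, smul_mul_assoc,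
      e.isIdempotentElem]
    refine inf_eq_right.2 ?_
    conv_rhs => rw [← one_smul A e.val]
    exact h.smul_le_smul_right h1 (h.val_nonneg e)
  · rw [h.inf_mul (h.val_nonneg _), e.val_mul_compl, smul_mul_assoc, one_mul, smul_mul_assoc,
      e.val_mul_compl, smul_zero]
    exact inf_eq_left.2 (h.smul_nonneg _ _ h0 (h.val_nonneg _))

/-- An element of a torsion-free `f`-algebra is idempotent if and only if `s = 2s ⊓ 1`. -/
theorem two_nsmul_inf_one_iff {s : S} : (2 : ℕ) • s ⊓ 1 = s ↔ s * s = s := by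
  have := h.isOrderedRing
  constructor
  · intro hs
    have h1 : s ⊓ (1 - s) = 0 := by
      have : (2 • s - s) ⊓ (1 - s) = 2 • s ⊓ 1 - s := (inf_sub _ _ _).symm
      rwa [hs, sub_self, two_nsmul, add_sub_cancel_right] at this
    have h2 : 0 ≤ s := h1 ▸ inf_le_left
    have h3 : 0 ≤ 1 - s := h1 ▸ inf_le_right
    have h4 := h.mul_inf_eq_zero _ _ (1 - s) h1 h3
    have h5 := h.mul_inf_eq_zero _ _ s ((inf_comm _ _).trans h4) h2
    rw [mul_comm (1 - s), inf_idem] at h5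
    linear_combination -h5
  · intro hs
    let e : Idem S := ⟨s, hs⟩
    have h1 : e.val ⊓ eᶜ.val = 0 := by
      rw [← h.val_inf_eq, inf_compl_self, Idem.val_bot]
    have h2 : (e.val + e.val) ⊓ (eᶜ.val + e.val) = e.val := by
      rw [← inf_add, h1, zero_add]
    rw [Idem.val_compl, sub_add_cancel, ← two_nsmul] at h2
    exact h2

/-- The idempotents as truncation levels. -/
theorem exists_level [IsOrderedRing A] (hS : IsSpecker A S) (s : S) (c : A) :
    ∃ l : Idem S, c • l.val ≤ s * l.val ∧
      (l = ⊤ ∨ ∃ c' < c, s * lᶜ.val ≤ c' • lᶜ.val) := by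
  classical
  have := h.isOrderedRing
  obtain ⟨ι, _, e, a, he, hse⟩ := hS.exists_decomposition s
  have hnn : ∀ i, 0 ≤ e i := fun i => h.val_nonneg ⟨e i, he.idem i⟩
  have hidem : IsIdempotentElem (∑ i with c ≤ a i, e i) :=
    he.toOrthogonalIdempotents.isIdempotentElem_sum
  have hcompl : 1 - ∑ i with c ≤ a i, e i = ∑ i with ¬ c ≤ a i, e i := by
    rw [← he.complete, ← Finset.sum_filter_add_sum_filter_not _ (fun i => c ≤ a i),
      add_sub_cancel_left]
  -- The level idempotent collects the pieces with coefficient at least `c`. The bound `c'` is the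
  -- largest remaining coefficient, so no bound is needed when no piece remains.
  refine ⟨⟨_, hidem⟩, ?_, ?_⟩
  · show c • (∑ i with c ≤ a i, e i) ≤ s * ∑ i with c ≤ a i, e i
    rw [Finset.smul_sum, Finset.mul_sum]
    refine Finset.sum_le_sum fun i hi => ?_
    rw [hse]
    exact h.smul_le_smul_right (Finset.mem_filter.1 hi).2 (hnn i)
  · rcases (Finset.univ.filter fun i => ¬ c ≤ a i).eq_empty_or_nonempty with hemp | hne
    · left
      rw [hemp, Finset.sum_empty, sub_eq_zero] at hcompl
      exact Idem.val_injective hcompl.symm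
    · right
      obtain ⟨j, hj, hmax⟩ := Finset.exists_max_image _ a hne
      refine ⟨a j, not_le.1 (Finset.mem_filter.1 hj).2, ?_⟩
      show s * (1 - ∑ i with c ≤ a i, e i) ≤ a j • (1 - ∑ i with c ≤ a i, e i)
      rw [hcompl, Finset.smul_sum, Finset.mul_sum]
      refine Finset.sum_le_sum fun i hi => ?_
      rw [hse]
      exact h.smul_le_smul_right (hmax i hi) (hnn i)

end IsTorsionFreeFAlgebra

/-! ### The proximity restricted to idempotents. -/

namespace IsProximitySpecker

variable [IsOrderedRing A] {prec : S → S → Prop} (h : IsProximitySpecker A prec)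
include h

omit [IsOrderedRing A] in
theorem prec_smul_one {a : A} (ha : 0 ≤ a) : prec (a • (1 : S)) (a • (1 : S)) := by
  rcases ha.eq_or_lt with rfl | ha
  · simpa using h.proximity.zero
  · exact h.proximity.smul _ _ a ha h.proximity.one

theorem prec_algebraMap (a : A) : prec (algebraMap A S a) (algebraMap A S a) := by
  rw [Algebra.algebraMap_eq_smul_one]
  rcases le_total 0 a with ha | ha
  · exact h.prec_smul_one ha
  · simpa using h.proximity.neg _ _ (h.prec_smul_one (neg_nonneg.2 ha))

omit [IsOrderedRing A] in
theorem prec_sup {s t r : S} (hs : prec s r) (ht : prec t r) : prec (s ⊔ t) r := by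
  have := h.fAlgebra.isOrderedAddMonoid
  have := h.proximity.neg _ _ (h.proximity.inf _ _ _ (h.proximity.neg _ _ hs)
    (h.proximity.neg _ _ ht))
  rwa [← neg_sup, neg_neg, neg_neg] at this

omit [IsOrderedRing A] in
theorem prec_compl {e k : Idem S} (hek : prec e.val k.val) : prec kᶜ.val eᶜ.val := by
  have := h.proximity.add _ _ _ _ h.proximity.one (h.proximity.neg _ _ hek)
  rwa [← sub_eq_add_neg, ← sub_eq_add_neg] at this

/-- Since also `a e ≤ a ≺ a`, the element `a e` is proximal to `k ⊓ a = a k`, and the positive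
scalar cancels. -/
theorem prec_of_smul_prec {a : A} (h0 : 0 < a) (h1 : a ≤ 1) {e k : Idem S}
    (hek : prec (a • e.val) k.val) : prec e.val k.val := by
  refine h.proximity.of_smul _ _ a h0 ?_
  rw [← h.fAlgebra.val_inf_smul_one h0.le h1 k]
  refine h.proximity.inf _ _ _ hek (h.proximity.mono _ _ _ _ ?_ (h.prec_smul_one h0.le) le_rfl)
  exact h.fAlgebra.smul_le_smul_left h0.le (h.fAlgebra.val_le_one e)

theorem isCompingent : IsCompingent (idemRel prec) where
  bot := h.proximity.zero
  le hab := h.fAlgebra.val_le_val_iff.1 (h.proximity.le _ _ hab)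
  mono hab hbc hcd := h.proximity.mono _ _ _ _ (h.fAlgebra.val_le_val_iff.2 hab) hbc
    (h.fAlgebra.val_le_val_iff.2 hcd)
  inf {a b c} hab hac := by
    show prec a.val (b ⊓ c).val
    rw [h.fAlgebra.val_inf_eq]
    exact h.proximity.inf _ _ _ hab hac
  compl hab := h.prec_compl hab
  interpolate {e k} hek := by
    have hf := h.fAlgebra
    have := hf.isOrderedRing
    -- The interpolant `s` need not be idempotent and is replaced by `l`, its level at `1`. Then `l
    -- ≤ s ≺ k`. Off `l`, `s` is at most some `c < 1`, so a positive multiple of `lᶜ` lies below `1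
    -- - s ≺ eᶜ`; cancelling the scalar gives `lᶜ ≺ eᶜ`.
    obtain ⟨s, hes, hsk⟩ := h.proximity.interpolate _ _ hek
    have hs0 : 0 ≤ s := (hf.val_nonneg e).trans (h.proximity.le _ _ hes)
    obtain ⟨l, hl, hl'⟩ := hf.exists_level h.specker s 1
    rw [one_smul] at hl
    refine ⟨l, ?_, h.proximity.mono _ _ _ _ (hl.trans (hf.mul_val_le hs0 l)) hsk le_rfl⟩
    rcases hl' with rfl | ⟨c, hc, hsc⟩
    · exact h.proximity.mono _ _ _ _ (hf.val_le_one e) h.proximity.one le_rfl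
    · have hsc' : s * lᶜ.val ≤ (c ⊔ 0) • lᶜ.val :=
        hsc.trans (hf.smul_le_smul_right le_sup_left (hf.val_nonneg _))
      have hs1 : 0 ≤ 1 - s :=
        sub_nonneg.2 ((h.proximity.le _ _ hsk).trans (hf.val_le_one k))
      have hle : (1 - c ⊔ 0) • lᶜ.val ≤ 1 - s := by
        refine le_trans ?_ (hf.mul_val_le hs1 lᶜ)
        rw [sub_smul, one_smul, sub_mul, one_mul]
        exact sub_le_sub_left hsc' _
      have hpr : prec (1 - s) eᶜ.val := by
        have := h.proximity.add _ _ _ _ h.proximity.one (h.proximity.neg _ _ hes)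
        rwa [← sub_eq_add_neg, ← sub_eq_add_neg] at this
      by_cases htriv : (1 : A) ≤ 0
      · have h01 : (1 : A) = 0 := le_antisymm htriv zero_le_one
        have hz : ∀ x : S, x = 0 := fun x => by rw [← one_smul A x, h01, zero_smul]
        show prec e.val l.val
        rw [hz e.val, hz l.val]
        exact h.proximity.zero
      have := h.prec_compl (h.prec_of_smul_prec (sub_pos.2 (sup_lt_iff.2 ⟨hc, not_le.1 htriv⟩))
        (sub_le_self _ le_sup_right) (h.proximity.mono _ _ _ _ hle hpr le_rfl))
      rwa [compl_compl, compl_compl] at this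
  exists_prec {k} hk := by
    have hf := h.fAlgebra
    have := hf.isOrderedRing
    have hk0 : 0 < k.val := (hf.val_nonneg k).lt_of_ne fun h0 => hk (Idem.val_injective h0.symm)
    obtain ⟨t, ht0, htk⟩ := h.proximity.exists_pos _ hk0
    obtain ⟨e, a, hte, hne⟩ := h.specker.exists_mul_eq_smul ht0.ne'
    refine ⟨e, ?_, ?_⟩
    · rintro rfl
      exact hne (by rw [Idem.val_bot, mul_zero])
    · have ha : 0 < a := by
        by_contra! ha
        refine hne (le_antisymm ?_ (hf.mul_nonneg _ _ ht0.le (hf.val_nonneg e)))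
        rw [hte]
        simpa using hf.smul_le_smul_right ha (hf.val_nonneg e)
      have h1 : (0 : A) < 1 := zero_le_one.lt_of_ne fun h01 => ha.ne
        (by rw [← one_mul a, ← h01, zero_mul])
      -- The coefficient of `t` on `e` is cut down to `a ⊓ 1` for the same reason.
      refine h.prec_of_smul_prec (lt_inf_iff.2 ⟨ha, h1⟩) inf_le_right
        (h.proximity.mono _ _ _ _ ?_ htk le_rfl)
      exact (hf.smul_le_smul_right inf_le_left (hf.val_nonneg e)).trans
        (hte ▸ hf.mul_val_le ht0.le e)

end IsProximitySpecker

end FAlgebra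

/-! ### Normal functions and their pullbacks. -/

section NormalFunctions

variable {X Y A : Type*} [TopologicalSpace X] [TopologicalSpace Y]

section Order

variable [LinearOrder A]

theorem normalize_congr {f g : X → A} (hf : (range f).Finite) (hg : (range g).Finite)
    (hfg : f = g) : normalize f hf = normalize g hg := by
  subst hfg
  rfl

theorem normalize_mem_range (f : X → A) (hf : (range f).Finite) (x : X) :
    ∃ y, f y = normalize f hf x := (normalizeFun_spec f hf x).1

theorem normalize_eq_of_regular {f : X → A} (hf : (range f).Finite)
    (hreg : ∀ a, interior (closure (f ⁻¹' Ici a)) = f ⁻¹' Ici a) (x : X) :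
    normalize f hf x = f x :=
  eq_of_forall_le_iff fun a => by rw [le_normalize_iff, hreg]; rfl

omit [TopologicalSpace X] in
theorem preimage_comp_monotone {f : X → A} (hf : (range f).Finite) {u : A → A} (hu : Monotone u)
    (b : A) : (∀ x, ¬ b ≤ u (f x)) ∨ ∃ y, b ≤ u (f y) ∧ ∀ x, b ≤ u (f x) ↔ f y ≤ f x := by
  by_cases hne : ∃ x, b ≤ u (f x)
  · obtain ⟨x, hx⟩ := hne
    obtain ⟨_, ⟨⟨y, rfl⟩, hy⟩, hmin⟩ :=
      (hf.subset (sep_subset (range f) fun c => b ≤ u c)).exists_minimal ⟨f x, mem_range_self x, hx⟩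
    refine Or.inr ⟨y, hy, fun z => ⟨fun hz => ?_, fun hz => le_trans hy (hu hz)⟩⟩
    rcases le_total (f y) (f z) with h | h
    · exact h
    · exact hmin ⟨mem_range_self z, hz⟩ h
  · exact Or.inl (not_exists.1 hne)

/-- For monotone `u`, every superlevel set of `u ∘ f` is empty or a superlevel set of `f`, so
normalization creates nothing new. Translations, nonnegative multiples and joins with constants are
all of this kind. -/
theorem normalize_comp_monotone {f : X → A} (hf : (range f).Finite) {u : A → A} (hu : Monotone u)
    (huf : (range fun x => u (f x)).Finite) (x : X) :
    normalize (fun x => u (f x)) huf x = u (normalize f hf x) := by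
  refine eq_of_forall_le_iff fun b => ?_
  obtain ⟨y, hy⟩ := normalize_mem_range f hf x
  rw [le_normalize_iff]
  rcases preimage_comp_monotone hf hu b with h | ⟨z, -, hc⟩
  · have : (fun x => u (f x)) ⁻¹' Ici b = ∅ := eq_empty_of_forall_notMem h
    rw [this, ← hy]
    simpa using h y
  · have : (fun x => u (f x)) ⁻¹' Ici b = f ⁻¹' Ici (f z) := ext hc
    rw [this, ← le_normalize_iff f hf, ← hy, hc]

namespace FN

theorem lift₁_apply_of_monotone {u : A → A} (hu : Monotone u) (f : FN X A) (x : X) :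
    lift₁ u f x = u (f x) := by
  have := normalize_comp_monotone f.finite hu (finite_range_op₁ u f) x
  rwa [normalize_eq_of_regular f.finite f.reg] at this

/-- A value of `f` below `c` that bounds all values below `c`. -/
theorem exists_lower_cut (f : FN X A) (c : A) :
    (∀ x, c ≤ f x) ∨ ∃ c' < c, ∀ x, c ≤ f x ∨ f x ≤ c' := by
  by_cases hall : ∀ x, c ≤ f x
  · exact Or.inl hall
  · push Not at hall
    obtain ⟨x, hx⟩ := hall
    obtain ⟨c', ⟨-, hc'⟩, hmax⟩ :=
      (f.finite.subset (sep_subset (range f) fun b => b < c)).exists_maximal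
        ⟨f x, mem_range_self x, hx⟩
    refine Or.inr ⟨c', hc', fun y => (le_or_gt c (f y)).imp_right fun hy => ?_⟩
    exact (le_total (f y) c').elim id fun hle => hmax ⟨mem_range_self y, hy⟩ hle

theorem inf_apply (f g : FN X A) (x : X) : (f ⊓ g) x = f x ⊓ g x := rfl

theorem sup_const_apply (f : FN X A) (a : A) (x : X) : (f ⊔ FN.const a) x = f x ⊔ a :=
  lift₁_apply_of_monotone (u := (· ⊔ a)) (fun _ _ h => sup_le_sup_right h a) f x

theorem prec_sup {f g k : FN X A} (hf : f.prec k) (hg : g.prec k) : (f ⊔ g).prec k := by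
  intro a
  have : ((f ⊔ g : FN X A) : X → A) ⁻¹' Ici a = interior (closure (f ⁻¹' Ici a ∪ g ⁻¹' Ici a)) := by
    ext x
    refine (le_normalize_iff _ _ x a).trans ?_
    rw [show (fun x => f x ⊔ g x) ⁻¹' Ici a = f ⁻¹' Ici a ∪ g ⁻¹' Ici a by ext; simp]
  rw [this]
  refine (closure_minimal interior_subset isClosed_closure).trans ?_
  rw [closure_union]
  exact union_subset (hf a) (hg a)

theorem le_of_prec {f g : FN X A} (hfg : f.prec g) : f ≤ g := fun x =>
  hfg (f x) (subset_closure (le_refl (f x)))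

theorem le_pullback_iff (φ : C(X, Y)) (f : FN Y A) (x : X) (a : A) :
    a ≤ pullback φ f x ↔ x ∈ interior (closure (φ ⁻¹' (f ⁻¹' Ici a))) :=
  le_normalize_iff _ _ x a

theorem isOpen_preimage_comp (φ : C(X, Y)) (f : FN Y A) (a : A) :
    IsOpen (φ ⁻¹' (f ⁻¹' Ici a)) := (f.isOpen_preimage a).preimage φ.continuous

theorem apply_le_pullback (φ : C(X, Y)) (f : FN Y A) (x : X) : f (φ x) ≤ pullback φ f x := by
  rw [le_pullback_iff]
  exact (isOpen_preimage_comp φ f _).subset_interior_closure (le_refl (f (φ x)))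

/-- The pullback is the least normal function above the composition, which reduces upper bounds to
pointwise ones. -/
theorem pullback_le_iff (φ : C(X, Y)) (f : FN Y A) (g : FN X A) :
    pullback φ f ≤ g ↔ ∀ x, f (φ x) ≤ g x := by
  refine ⟨fun h x => (apply_le_pullback φ f x).trans (h x), fun h x => ?_⟩
  have hx := (le_pullback_iff φ f x _).1 le_rfl
  have : x ∈ interior (closure (g ⁻¹' Ici (pullback φ f x))) :=
    interior_mono (closure_mono fun y hy => le_trans hy (h y)) hx
  rwa [g.reg] at this

theorem pullback_mono (φ : C(X, Y)) {f g : FN Y A} (hfg : f ≤ g) :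
    pullback φ f ≤ pullback φ g :=
  (pullback_le_iff φ f _).2 fun x => (hfg (φ x)).trans (apply_le_pullback φ g x)

theorem pullback_inf (φ : C(X, Y)) (f g : FN Y A) :
    pullback φ (f ⊓ g) = pullback φ f ⊓ pullback φ g := by
  refine FN.ext fun x => eq_of_forall_le_iff fun a => ?_
  rw [inf_apply, le_inf_iff, le_pullback_iff, le_pullback_iff, le_pullback_iff, ← mem_inter_iff,
    ← interior_closure_inter (isOpen_preimage_comp φ f a), ← preimage_inter]
  rw [show ((f ⊓ g : FN Y A) : Y → A) ⁻¹' Ici a = f ⁻¹' Ici a ∩ g ⁻¹' Ici a by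
    ext; simp [inf_apply]]

theorem pullback_lift₁ (φ : C(X, Y)) {u : A → A} (hu : Monotone u) (f : FN Y A) :
    pullback φ (lift₁ u f) = lift₁ u (pullback φ f) := by
  refine FN.ext fun x => ?_
  rw [lift₁_apply_of_monotone hu]
  refine Eq.trans ?_ (normalize_comp_monotone _ hu
    ((f.finite.image u).subset (by
      rintro _ ⟨x, rfl⟩; exact mem_image_of_mem u (mem_range_self _))) x)
  exact congrArg (fun k : FN X A => k x)
    (normalize_congr _ _ (funext fun x => lift₁_apply_of_monotone hu f (φ x)))

theorem pullback_const (φ : C(X, Y)) (a : A) :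
    pullback φ (FN.const a : FN Y A) = FN.const a :=
  FN.ext fun x => normalize_eq_of_regular _ (FN.const a : FN X A).reg x

theorem pullback_sup_const (φ : C(X, Y)) (f : FN Y A) (a : A) :
    pullback φ (f ⊔ FN.const a) = pullback φ f ⊔ FN.const a :=
  pullback_lift₁ φ (u := (· ⊔ a)) (fun _ _ h => sup_le_sup_right h a) f

/-- The composition need not be normal, but its superlevel sets are open. Hence it is locally
constant wherever it attains its maximum over an open set. -/
theorem dense_constSet_comp (φ : C(X, Y)) (f : FN Y A) : Dense (constSet fun x => f (φ x)) := by
  rw [dense_iff_inter_open]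
  intro V hV hne
  obtain ⟨_, ⟨⟨y, hy, rfl⟩, hmax⟩⟩ := (f.finite.subset
    ((image_subset_range (fun x => f (φ x)) V).trans (range_comp_subset_range φ f))).exists_maximal
      (hne.image _)
  refine ⟨y, hy, ?_⟩
  have hmem : V ∩ φ ⁻¹' (f ⁻¹' Ici (f (φ y))) ∈ 𝓝 y :=
    (hV.inter (isOpen_preimage_comp φ f _)).mem_nhds ⟨hy, le_refl (f (φ y))⟩
  show ∀ᶠ z in 𝓝 y, f (φ z) = f (φ y)
  filter_upwards [hmem] with z hz
  exact le_antisymm (hmax (mem_image_of_mem (fun x => f (φ x)) hz.1) hz.2) hz.2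

theorem eq_on_of_forall_mem {f : FN X A} {U D : Set X} (hU : IsOpen U) (hD : Dense D) {a : A}
    (h : ∀ x ∈ U ∩ D, a ≤ f x) : ∀ x ∈ U, a ≤ f x := by
  intro x hx
  have hsub : U ⊆ interior (closure (f ⁻¹' Ici a)) := interior_maximal
    ((hD.open_subset_closure_inter hU).trans (closure_mono h)) hU
  rw [f.reg] at hsub
  exact hsub hx

end FN

end Order

section Ring

variable [CommRing A] [LinearOrder A]

namespace FN

theorem algebraMap_eq (a : A) : algebraMap A (FN X A) a = FN.const a := rfl

theorem zero_apply (x : X) : (0 : FN X A) x = 0 := rfl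

variable [IsOrderedRing A]

theorem smul_apply {b : A} (hb : 0 ≤ b) (f : FN X A) (x : X) : (b • f) x = b * f x :=
  lift₁_apply_of_monotone (u := (b * ·)) (monotone_mul_left_of_nonneg hb) f x

theorem add_const_apply (f : FN X A) (a : A) (x : X) : (f + FN.const a : FN X A) x = f x + a :=
  lift₁_apply_of_monotone (u := (· + a)) add_left_mono f x

theorem pullback_smul (φ : C(X, Y)) {b : A} (hb : 0 ≤ b) (f : FN Y A) :
    pullback φ (b • f) = b • pullback φ f :=
  pullback_lift₁ φ (u := (b * ·)) (monotone_mul_left_of_nonneg hb) f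

theorem pullback_add_const (φ : C(X, Y)) (f : FN Y A) (a : A) :
    pullback φ (f + FN.const a) = pullback φ f + FN.const a :=
  pullback_lift₁ φ (u := (· + a)) add_left_mono f

omit [IsOrderedRing A] in
theorem pullback_add (φ : C(X, Y)) {f g : FN Y A} (hfg : ∀ y, (f + g) y = f y + g y) :
    pullback φ (f + g) = pullback φ f + pullback φ g := by
  refine FN.ext_of_dense ((dense_constSet_comp φ f).inter_of_isOpen_left
    (dense_constSet_comp φ g) (isOpen_constSet _)) fun x hx => ?_
  refine Eq.trans ?_ (lift₂_apply (· + ·) (mem_constSet_normalize _ hx.1)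
    (mem_constSet_normalize _ hx.2)).symm
  have hx1 : ∀ᶠ y in 𝓝 x, f (φ y) = f (φ x) := hx.1
  have hx2 : ∀ᶠ y in 𝓝 x, g (φ y) = g (φ x) := hx.2
  have hmem : x ∈ constSet fun x => (f + g) (φ x) := by
    show ∀ᶠ y in 𝓝 x, (f + g) (φ y) = (f + g) (φ x)
    filter_upwards [hx1, hx2] with y h1 h2
    rw [hfg, hfg, h1, h2]
  refine (normalize_apply_of_mem _ hmem).trans ?_
  rw [hfg]
  exact congrArg₂ (· + ·) (normalize_apply_of_mem _ hx.1).symm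
    (normalize_apply_of_mem _ hx.2).symm

/-- Sums of comonotone normal functions are pointwise. -/
theorem add_apply_of_comonotone {f g : FN X A}
    (hfg : ∀ x y, f x ≤ f y ∧ g x ≤ g y ∨ f y ≤ f x ∧ g y ≤ g x) (x : X) :
    (f + g) x = f x + g x := by
  refine normalize_eq_of_regular _ (fun c => ?_) x
  by_cases hne : ((fun x => f x + g x) ⁻¹' Ici c).Nonempty
  · obtain ⟨_, ⟨⟨y, hy, rfl⟩, hmin⟩⟩ := ((finite_range_op₂ (· + ·) f g).subset
      (image_subset_range _ ((fun x => f x + g x) ⁻¹' Ici c))).exists_minimal (hne.image _)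
    -- Here `y` minimizes the sum on its superlevel set. If both values at `z` are at most those at
    -- `y`, minimality and cancellation make them equal, so comonotonicity turns the superlevel set
    -- into an intersection.
    have : (fun x => f x + g x) ⁻¹' Ici c = f ⁻¹' Ici (f y) ∩ g ⁻¹' Ici (g y) := by
      ext z
      constructor
      · intro hz
        rcases hfg y z with h | h
        · exact h
        · have hle : f y + g y ≤ f z + g z :=
            hmin (mem_image_of_mem _ hz) (add_le_add h.1 h.2)
          exact ⟨show f y ≤ f z from le_of_add_le_add_right (hle.trans (add_le_add le_rfl h.2)), 
            show g y ≤ g z from le_of_add_le_add_left (hle.trans (add_le_add h.1 le_rfl))⟩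
      · intro hz
        exact le_trans (show c ≤ f y + g y from hy) (add_le_add hz.1 hz.2)
    rw [this, interior_closure_inter (f.isOpen_preimage _), f.reg, g.reg]
  · rw [not_nonempty_iff_eq_empty.1 hne]; simp

/-- The characteristic function of a regular open set. -/
noncomputable def char (U : Set X) (hU : interior (closure U) = U) : FN X A where
  toFun := U.indicator 1
  finite_range := (toFinite {0, 1}).subset (by
    rintro _ ⟨x, rfl⟩
    by_cases hx : x ∈ U <;> simp [hx])
  regular a := by
    by_cases h0 : a ≤ 0
    · have : U.indicator (1 : X → A) ⁻¹' Ici a = univ := by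
        ext x
        by_cases hx : x ∈ U <;> simp [hx, h0, h0.trans zero_le_one]
      rw [this]; simp
    · by_cases h1 : a ≤ 1
      · have : U.indicator (1 : X → A) ⁻¹' Ici a = U := by
          ext x
          by_cases hx : x ∈ U <;> simp [hx, h0, h1]
        rw [this, hU]
      · have : U.indicator (1 : X → A) ⁻¹' Ici a = ∅ := by
          ext x
          by_cases hx : x ∈ U <;> simp [hx, h0, h1]
        rw [this]; simp

theorem add_smul_indicator_apply {f k : FN X A} {b : A} (hb : 0 ≤ b) {U : Set X}
    (hk : ⇑k = U.indicator 1) (hf : ∀ x, ∀ y ∈ U, f x ≤ f y) (x : X) :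
    (f + b • k) x = f x + b * k x := by
  rw [add_apply_of_comonotone, smul_apply hb]
  intro x y
  rw [smul_apply hb, smul_apply hb, hk]
  by_cases hx : x ∈ U <;> by_cases hy : y ∈ U
  · simp [hx, hy, le_total]
  · simp [hx, hy, hb, hf y x hx]
  · simp [hx, hy, hb, hf x y hy]
  · simp [hx, hy, le_total]

/-- Each partial sum attains its maximum throughout the next, smaller set, so it is comonotone with
the next summand. -/
theorem decreasing_sum_apply {n : ℕ} (a : A) {b : Fin n → A} (hb : ∀ i, 0 ≤ b i)
    {k : Fin n → FN X A} {U : Fin n → Set X} (hk : ∀ i, ⇑(k i) = (U i).indicator 1)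
    (hU : Antitone U) (x : X) :
    (algebraMap A (FN X A) a + ∑ i, b i • k i) x = a + ∑ i, b i * k i x := by
  induction n generalizing x with
  | zero => simp [algebraMap_eq, const_apply]
  | succ n ih =>
    have ih' := ih (b := fun i => b i.castSucc) (fun i => hb _) (k := fun i => k i.castSucc)
      (U := fun i => U i.castSucc) (fun i => hk _)
      fun i j hij => hU (Fin.castSucc_le_castSucc_iff.2 hij)
    rw [Fin.sum_univ_castSucc, Fin.sum_univ_castSucc, ← add_assoc,
      add_smul_indicator_apply (hb _) (hk (Fin.last n)), ih', add_assoc]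
    intro y z hz
    rw [ih', ih']
    refine add_le_add le_rfl (Finset.sum_le_sum fun i _ => mul_le_mul_of_nonneg_left ?_ (hb _))
    rw [hk, indicator_of_mem (hU (Fin.le_last _) hz)]
    exact indicator_le_self' (by simp) y

theorem pullback_decreasing_sum (φ : C(X, Y)) {n : ℕ} (a : A) {b : Fin n → A}
    (hb : ∀ i, 0 ≤ b i) {k : Fin n → FN Y A} {U : Fin n → Set Y}
    (hk : ∀ i, ⇑(k i) = (U i).indicator 1) (hU : Antitone U) :
    pullback φ (algebraMap A (FN Y A) a + ∑ i, b i • k i)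
      = algebraMap A (FN X A) a + ∑ i, b i • pullback φ (k i) := by
  induction n with
  | zero => simp [algebraMap_eq, pullback_const]
  | succ n ih =>
    have hU' : Antitone fun i : Fin n => U i.castSucc :=
      fun i j hij => hU (Fin.castSucc_le_castSucc_iff.2 hij)
    have happ := decreasing_sum_apply a (b := fun i => b i.castSucc) (fun i => hb _)
      (k := fun i => k i.castSucc) (U := fun i => U i.castSucc) (fun i => hk _) hU'
    rw [Fin.sum_univ_castSucc, Fin.sum_univ_castSucc, ← add_assoc, pullback_add φ fun y => ?_,
      pullback_smul φ (hb _), ih (fun i => hb _) (fun i => hk _) hU', add_assoc]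
    rw [add_smul_indicator_apply (hb _) (hk (Fin.last n)), smul_apply (hb _)]
    intro y z hz
    rw [happ, happ]
    refine add_le_add le_rfl (Finset.sum_le_sum fun i _ => mul_le_mul_of_nonneg_left ?_ (hb _))
    rw [hk, indicator_of_mem (hU (Fin.le_last _) hz)]
    exact indicator_le_self' (by simp) y

theorem neg_pullback_neg_prec (φ : C(X, Y)) {f g : FN Y A} (hfg : f.prec g) :
    (-pullback φ (-f)).prec (pullback φ g) := by
  -- If `f < c` near `y`, let `f z` be the maximum of `f` on a neighbourhood. There `-f ≥ -f z`, so
  -- the normalized negative at `y` is at least `-f z`, which exceeds `-c`.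
  have hmem : ∀ y c, (-f) y ≤ -c → y ∈ closure (f ⁻¹' Ici c) := by
    intro y c hy
    by_contra hcon
    obtain ⟨V, hV, hVo, hyV⟩ := mem_nhds_iff.1 (isClosed_closure.isOpen_compl.mem_nhds hcon)
    have hlt : ∀ z ∈ V, f z < c := fun z hz => not_le.1 fun hcz => hV hz (subset_closure hcz)
    obtain ⟨_, ⟨⟨z, hz, rfl⟩, hmax⟩⟩ := (f.finite.subset (image_subset_range f V)).exists_maximal
      ⟨f y, mem_image_of_mem f hyV⟩
    have hle : -f z ≤ (-f) y := by
      refine (le_normalize_iff _ _ y _).2 ?_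
      refine interior_maximal (Subset.trans ?_ subset_closure) hVo hyV
      intro w hw
      refine neg_le_neg ?_
      rcases le_total (f w) (f z) with h | h
      · exact h
      · exact hmax (mem_image_of_mem f hw) h
    exact absurd (hlt z hz) (not_lt.2 (neg_le_neg_iff.1 (hle.trans hy)))
  intro c
  have hsub : (-pullback φ (-f)) ⁻¹' Ici c ⊆
      closure ((fun x => -pullback φ (-f) x) ⁻¹' Ici c) := fun x hx =>
    interior_subset ((le_normalize_iff _ _ x c).1 hx)
  have hsub' : (fun x => -pullback φ (-f) x) ⁻¹' Ici c ⊆ φ ⁻¹' closure (f ⁻¹' Ici c) :=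
    fun x hx => hmem _ _ ((apply_le_pullback φ (-f) x).trans (le_neg.1 hx))
  refine (closure_minimal (hsub.trans (closure_minimal hsub' ?_)) ?_).trans fun x hx =>
    le_trans (show c ≤ g (φ x) from hfg c hx) (apply_le_pullback φ g x)
  all_goals exact isClosed_closure.preimage φ.continuous

end FN

end Ring

end NormalFunctions

/-! ### The canonical embedding into normal functions. -/

section Representation

variable {A S : Type*} [CommRing A] [LinearOrder A] [CommRing S] [Algebra A S]

/-- The normal function `g` represents `s` if, on a dense set of ends, the value of `g` is the
value that `s` takes on some idempotent of the end. -/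
def Represents (prec : S → S → Prop) (s : S) (g : FN (EndSpace (idemRel prec)) A) : Prop :=
  ∃ D : Set (EndSpace (idemRel prec)), IsOpen D ∧ Dense D ∧
    ∀ x ∈ D, ∃ e : Idem S, x ∈ zeta (idemRel prec) e ∧ s * e.val = g x • e.val

open IsCompingent

/-- A canonical embedding for which the preimages of the sets `{b | c ≤ b}` are basic. -/
structure IsLevelEmbedding (A : Type*) {S : Type*} [CommRing A] [LinearOrder A] [CommRing S]
    [Algebra A S] [Lattice S] (prec : S → S → Prop)
    (η : S →ₐ[A] FN (EndSpace (idemRel prec)) A) : Prop extends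
    IsCanonicalEmbedding A prec η where
  exists_level : ∀ s c, ∃ l : Idem S, ∀ x, c ≤ η s x ↔ x ∈ zeta (idemRel prec) l

theorem Represents.of_eq_const {prec : S → S → Prop} (a : A) :
    Represents prec (algebraMap A S a) (FN.const a) :=
  ⟨univ, isOpen_univ, dense_univ, fun x _ => ⟨⊤, by rw [zeta_top]; trivial, by
    rw [const_apply, Algebra.smul_def]⟩⟩

/-- Normalized operations are pointwise where both functions are locally constant. This set is open
and dense, and the meet of the two witnessing idempotents serves both elements. -/
theorem Represents.op {prec : S → S → Prop} {s t r : S} {f g k : FN (EndSpace (idemRel prec)) A}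
    (hs : Represents prec s f) (ht : Represents prec t g)
    (hr : ∀ x ∈ constSet f, x ∈ constSet g → ∀ e : Idem S, s * e.val = f x • e.val →
      t * e.val = g x • e.val → r * e.val = k x • e.val) :
    Represents prec r k := by
  obtain ⟨D, hD, hDd, hf⟩ := hs
  obtain ⟨D', hD', hDd', hg⟩ := ht
  refine ⟨D ∩ D' ∩ (constSet f ∩ constSet g),
    (hD.inter hD').inter ((isOpen_constSet f).inter (isOpen_constSet g)),
    (hDd.inter_of_isOpen_left hDd' hD).inter_of_isOpen_left
      ((dense_constSet f).inter_of_isOpen_left (dense_constSet g) (isOpen_constSet f))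
      (hD.inter hD'), ?_⟩
  rintro x ⟨⟨hxD, hxD'⟩, hxf, hxg⟩
  obtain ⟨e, hxe, he⟩ := hf x hxD
  obtain ⟨e', hxe', he'⟩ := hg x hxD'
  refine ⟨e ⊓ e', by rw [zeta_inf]; exact ⟨hxe, hxe'⟩, hr x hxf hxg _ ?_ ?_⟩
  · rw [Idem.val_inf, ← mul_assoc, he, smul_mul_assoc]
  · rw [Idem.val_inf, mul_left_comm, he', mul_smul_comm]

theorem Represents.add {prec : S → S → Prop} {s t : S} {f g : FN (EndSpace (idemRel prec)) A}
    (hs : Represents prec s f) (ht : Represents prec t g) : Represents prec (s + t) (f + g) :=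
  hs.op ht fun x hf hg e hse hte => by
    rw [show (f + g : FN _ A) x = f x + g x from lift₂_apply _ hf hg, add_mul, hse, hte, add_smul]

theorem Represents.mul {prec : S → S → Prop} {s t : S} {f g : FN (EndSpace (idemRel prec)) A}
    (hs : Represents prec s f) (ht : Represents prec t g) : Represents prec (s * t) (f * g) :=
  hs.op ht fun x hf hg e hse hte => by
    rw [show (f * g : FN _ A) x = f x * g x from lift₂_apply _ hf hg, mul_assoc, hte,
      mul_smul_comm, hse, smul_smul, mul_comm]

variable [Lattice S] {prec : S → S → Prop}

theorem IsTorsionFreeFAlgebra.smul_val_le_iff [IsOrderedRing A] (hf : IsTorsionFreeFAlgebra A S)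
    {e : Idem S} (he : e ≠ ⊥) {a b : A} : a • e.val ≤ b • e.val ↔ a ≤ b := by
  refine ⟨fun h => ?_, fun h => hf.smul_le_smul_right h (hf.val_nonneg e)⟩
  by_contra! hba
  have heq := le_antisymm h (hf.smul_le_smul_right hba.le (hf.val_nonneg e))
  rw [← sub_eq_zero, ← sub_smul] at heq
  rcases hf.torsion_free _ _ heq with h0 | h0
  · exact hba.ne' (sub_eq_zero.1 h0)
  · exact he (Idem.val_injective h0)

variable [IsOrderedRing A] (h : IsProximitySpecker A prec)
include h

theorem Represents.inf {s t : S} {f g : FN (EndSpace (idemRel prec)) A}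
    (hs : Represents prec s f) (ht : Represents prec t g) : Represents prec (s ⊓ t) (f ⊓ g) :=
  hs.op ht fun x _ _ e hse hte => by
    have hf := h.fAlgebra
    rw [hf.inf_mul (hf.val_nonneg e), hse, hte, hf.smul_inf_smul _ _ (hf.val_nonneg e)]
    rfl

theorem Represents.sup {s t : S} {f g : FN (EndSpace (idemRel prec)) A}
    (hs : Represents prec s f) (ht : Represents prec t g) : Represents prec (s ⊔ t) (f ⊔ g) :=
  hs.op ht fun x hxf hxg e hse hte => by
    have hf := h.fAlgebra
    rw [show (f ⊔ g : FN _ A) x = f x ⊔ g x from lift₂_apply _ hxf hxg,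
      hf.sup_mul (hf.val_nonneg e), hse, hte, hf.smul_sup_smul _ _ (hf.val_nonneg e)]

theorem Represents.of_idem (e : Idem S) : Represents prec e.val
    (FN.char (zeta (idemRel prec) e) (h.isCompingent.interior_closure_zeta e) : FN _ A) := by
  have hc := h.isCompingent
  refine ⟨zeta (idemRel prec) e ∪ zeta (idemRel prec) eᶜ, (isOpen_zeta _).union (isOpen_zeta _),
    ?_, ?_⟩
  · rw [dense_iff_inter_open]
    intro V hV hne
    by_contra hcon
    rw [not_nonempty_iff_eq_empty, ← disjoint_iff_inter_eq_empty, disjoint_union_right] at hcon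
    obtain ⟨x, hx⟩ := hne
    exact hcon.1.ne_of_mem hx (hc.isOpen_subset_zeta_of_disjoint hV hcon.2 hx) rfl
  · rintro x (hx | hx)
    · refine ⟨e, hx, ?_⟩
      rw [show FN.char (zeta (idemRel prec) e) _ x = (1 : A) from indicator_of_mem hx 1,
        e.isIdempotentElem, one_smul]
    · refine ⟨eᶜ, hx, ?_⟩
      have hx' : x ∉ zeta (idemRel prec) e := fun hxe =>
        (disjoint_zeta_compl e).ne_of_mem hxe hx rfl
      rw [show FN.char (zeta (idemRel prec) e) _ x = (0 : A) from indicator_of_notMem hx' 1,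
        e.val_mul_compl, zero_smul]

omit [IsOrderedRing A] in
-- Two values at one end agree after multiplication by a common idempotent of that end. It is
-- nonzero, so torsion-freeness identifies the values.
theorem Represents.unique {s : S} {f g : FN (EndSpace (idemRel prec)) A}
    (hf : Represents prec s f) (hg : Represents prec s g) : f = g := by
  obtain ⟨D, hD, hDd, hf⟩ := hf
  obtain ⟨D', hD', hDd', hg⟩ := hg
  refine FN.ext_of_dense (hDd.inter_of_isOpen_left hDd' hD) ?_
  rintro x ⟨hxD, hxD'⟩
  obtain ⟨e, hxe, he⟩ := hf x hxD
  obtain ⟨e', hxe', he'⟩ := hg x hxD'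
  have h1 : f x • (e ⊓ e').val = g x • (e ⊓ e').val := by
    rw [Idem.val_inf, ← smul_mul_assoc, ← he, ← mul_smul_comm, ← he']
    ring
  rw [← sub_eq_zero, ← sub_smul] at h1
  rcases h.fAlgebra.torsion_free _ _ h1 with h0 | h0
  · exact sub_eq_zero.1 h0
  · have hmem : x ∈ zeta (idemRel prec) (e ⊓ e') := by rw [zeta_inf]; exact ⟨hxe, hxe'⟩
    rw [show e ⊓ e' = ⊥ from Idem.val_injective h0, zeta_bot] at hmem
    exact hmem.elim

theorem exists_represents (s : S) : ∃ g : FN (EndSpace (idemRel prec)) A, Represents prec s g := by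
  obtain ⟨B, -, hB⟩ := h.specker
  have hs : s ∈ Algebra.adjoin A (Idem.val '' (B : Set (Idem S))) := hB ▸ Algebra.mem_top
  induction hs using Algebra.adjoin_induction with
  | mem x hx =>
    obtain ⟨e, -, rfl⟩ := hx
    exact ⟨_, Represents.of_idem h e⟩
  | algebraMap r => exact ⟨_, Represents.of_eq_const r⟩
  | add x y _ _ hx hy =>
    obtain ⟨f, hf⟩ := hx
    obtain ⟨g, hg⟩ := hy
    exact ⟨_, hf.add hg⟩
  | mul x y _ _ hx hy =>
    obtain ⟨f, hf⟩ := hx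
    obtain ⟨g, hg⟩ := hy
    exact ⟨_, hf.mul hg⟩

theorem exists_algHom_represents :
    ∃ η : S →ₐ[A] FN (EndSpace (idemRel prec)) A, ∀ s, Represents prec s (η s) := by
  choose η hη using exists_represents h
  have hconst : ∀ a : A, η (algebraMap A S a) = FN.const a := fun a =>
    (hη _).unique h (Represents.of_eq_const a)
  exact ⟨{ toFun := η
           map_one' := (congrArg η (map_one _)).symm.trans (hconst 1)
           map_zero' := (congrArg η (map_zero _)).symm.trans (hconst 0)
           map_mul' := fun s t => (hη _).unique h ((hη s).mul (hη t))
           map_add' := fun s t => (hη _).unique h ((hη s).add (hη t))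
           commutes' := hconst }, hη⟩

theorem Represents.eq_zero {s : S} (hs : Represents prec s (0 : FN (EndSpace (idemRel prec)) A)) :
    s = 0 := by
  by_contra hne
  obtain ⟨e, a, hse, hse0⟩ := h.specker.exists_mul_eq_smul hne
  have he : e ≠ ⊥ := by
    rintro rfl
    exact hse0 (by rw [Idem.val_bot, mul_zero])
  obtain ⟨D, hD, hDd, hf⟩ := hs
  obtain ⟨x, hxe, hxD⟩ := hDd.inter_open_nonempty _ (isOpen_zeta e)
    (h.isCompingent.zeta_nonempty he)
  obtain ⟨k, hxk, hk⟩ := hf x hxD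
  rw [FN.zero_apply, zero_smul] at hk
  have h1 : a • (e ⊓ k).val = 0 := by
    rw [Idem.val_inf, ← smul_mul_assoc, ← hse, mul_right_comm, hk, zero_mul]
  rcases h.fAlgebra.torsion_free _ _ h1 with h0 | h0
  · exact hse0 (by rw [hse, h0, zero_smul])
  · have hmem : x ∈ zeta (idemRel prec) (e ⊓ k) := by rw [zeta_inf]; exact ⟨hxe, hxk⟩
    rw [show e ⊓ k = ⊥ from Idem.val_injective h0, zeta_bot] at hmem
    exact hmem

/-- At a densely chosen end, multiplying by an idempotent of the end turns inequalities in `S` into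
inequalities of scalars. Regularity of the level sets carries the result to all ends. -/
theorem Represents.le_iff_mem_zeta {s : S} {g : FN (EndSpace (idemRel prec)) A}
    (hs : Represents prec s g) {c : A} {l : Idem S} (hl : c • l.val ≤ s * l.val)
    (hl' : l = ⊤ ∨ ∃ c' < c, s * lᶜ.val ≤ c' • lᶜ.val) (x : EndSpace (idemRel prec)) :
    c ≤ g x ↔ x ∈ zeta (idemRel prec) l := by
  have hf := h.fAlgebra
  have hc := h.isCompingent
  obtain ⟨D, hD, hDd, hg⟩ := hs
  have key : ∀ y (e k : Idem S), y ∈ zeta (idemRel prec) e → y ∈ zeta (idemRel prec) k →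
      e ⊓ k ≠ ⊥ := by
    intro y e k hye hyk h0
    have hmem : y ∈ zeta (idemRel prec) (e ⊓ k) := by rw [zeta_inf]; exact ⟨hye, hyk⟩
    rw [h0, zeta_bot] at hmem
    exact hmem
  constructor
  · rcases hl' with rfl | ⟨c', hc', hsc⟩
    · intro _
      rw [zeta_top]
      trivial
    · intro hx
      refine hc.isOpen_subset_zeta_of_disjoint (g.isOpen_preimage c) ?_ hx
      rw [disjoint_iff_inter_eq_empty, ← not_nonempty_iff_eq_empty]
      intro hne
      obtain ⟨y, ⟨hyc, hyl⟩, hyD⟩ := hDd.inter_open_nonempty _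
        ((g.isOpen_preimage c).inter (isOpen_zeta _)) hne
      obtain ⟨e, hye, he⟩ := hg y hyD
      have h1 := hf.mul_val_le_mul_val hsc e
      rw [mul_right_comm, he, smul_mul_assoc, smul_mul_assoc, mul_comm lᶜ.val, ← Idem.val_inf,
        hf.smul_val_le_iff (key y e _ hye hyl)] at h1
      exact absurd (hc'.trans_le hyc) (not_lt.2 h1)
  · refine FN.eq_on_of_forall_mem (isOpen_zeta l) hDd ?_ x
    rintro y ⟨hyl, hyD⟩
    obtain ⟨e, hye, he⟩ := hg y hyD
    have h1 := hf.mul_val_le_mul_val hl e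
    rwa [mul_right_comm, he, smul_mul_assoc, smul_mul_assoc, mul_comm l.val, ← Idem.val_inf,
      hf.smul_val_le_iff (key y e _ hye hyl)] at h1

omit h in
/-- Approximation of a normal function by elements of a Specker algebra. -/
theorem exists_approx (hc : IsCompingent (idemRel prec))
    {η : S →ₐ[A] FN (EndSpace (idemRel prec)) A}
    (hidem : ∀ e : Idem S, ⇑(η e.val) = (zeta (idemRel prec) e).indicator 1)
    (hsup : ∀ s t, η (s ⊔ t) = η s ⊔ η t)
    {f g : FN (EndSpace (idemRel prec)) A} (hfg : f.prec g) (Q : S → Prop)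
    (hQsup : ∀ s t, Q s → Q t → Q (s ⊔ t))
    (hQ : ∀ (v c : A) (k : Idem S), v ≤ c → (∀ y, v ≤ g y) →
      (∀ y ∉ zeta (idemRel prec) kᶜ, c ≤ g y) → Q (algebraMap A S v + (c - v) • k.val)) :
    ∃ u, Q u ∧ f.prec (η u) := by
  have happ : ∀ (v c : A) (k : Idem S), v ≤ c → ∀ y, η (algebraMap A S v + (c - v) • k.val) y =
      (c - v) * (zeta (idemRel prec) k).indicator 1 y + v := by
    intro v c k hvc y
    rw [map_add, AlgHom.commutes, map_smul, add_comm, FN.algebraMap_eq, FN.add_const_apply,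
      FN.smul_apply (sub_nonneg.2 hvc), hidem]
  rcases isEmpty_or_nonempty (EndSpace (idemRel prec)) with hemp | ⟨⟨y₀⟩⟩
  · exact ⟨_, hQ 0 0 ⊥ le_rfl (fun y => hemp.elim y) (fun y => hemp.elim y),
      fun _ y => hemp.elim y⟩
  obtain ⟨_, ⟨⟨m, rfl⟩, hmin⟩⟩ := f.finite.exists_minimal ⟨f y₀, mem_range_self y₀⟩
  have hm : ∀ y, f m ≤ f y := fun y => (le_total (f m) (f y)).elim id
    fun hle => hmin (mem_range_self y) hle
  have hle := FN.le_of_prec hfg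
  -- The approximant is a finite join of two-valued elements with base value `f m`, the minimum of
  -- `f`, and one upper value for each value `c` of `f`. Since `Q` is closed under joins, it only
  -- has to be known for two-valued elements.
  have hfin : ∀ F : Finset A, ∃ u, Q u ∧ (∀ y, f m ≤ η u y) ∧
      ∀ c ∈ F, f m ≤ c → closure (f ⁻¹' Ici c) ⊆ η u ⁻¹' Ici c := by
    classical
    intro F
    induction F using Finset.induction_on with
    | empty =>
      refine ⟨_, hQ (f m) (f m) ⊥ le_rfl (fun y => (hm y).trans (hle y)) fun y hy => ?_, ?_, ?_⟩
      · exact (hm y).trans (hle y)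
      · intro y
        rw [happ _ _ _ le_rfl]
        simp
      · simp
    | insert c F _ ih =>
      obtain ⟨u, hu, hmu, huF⟩ := ih
      by_cases hmc : f m ≤ c
      · obtain ⟨k, hk, hkg⟩ := hc.exists_between isClosed_closure (g.isOpen_preimage c) (hfg c)
        have hle1 : ∀ y, η u y ≤ η (u ⊔ (algebraMap A S (f m) + (c - f m) • k.val)) y := by
          rw [hsup]; exact le_sup_left (a := η u)
        have hle2 : ∀ y, η (algebraMap A S (f m) + (c - f m) • k.val) y ≤
            η (u ⊔ (algebraMap A S (f m) + (c - f m) • k.val)) y := by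
          rw [hsup]; exact le_sup_right (a := η u)
        refine ⟨_, hQsup u _ hu (hQ (f m) c k hmc (fun y => (hm y).trans (hle y)) hkg),
          fun y => (hmu y).trans (hle1 y), fun c' hc' hmc' => ?_⟩
        rcases Finset.mem_insert.1 hc' with rfl | hc'
        · intro y hy
          refine le_trans ?_ (hle2 y)
          rw [happ _ _ _ hmc, indicator_of_mem (hk hy)]
          simp
        · exact (huF c' hc' hmc').trans fun y hy => le_trans hy (hle1 y)
      · refine ⟨u, hu, hmu, fun c' hc' hmc' => ?_⟩
        rcases Finset.mem_insert.1 hc' with rfl | hc'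
        · exact absurd hmc' hmc
        · exact huF c' hc' hmc'
  obtain ⟨u, hu, -, huF⟩ := hfin f.finite.toFinset
  refine ⟨u, hu, fun a => ?_⟩
  rcases preimage_comp_monotone f.finite monotone_id a with hemp | ⟨z, haz, hz⟩
  · rw [show f ⁻¹' Ici a = ∅ from eq_empty_of_forall_notMem hemp]
    simp
  · rw [show f ⁻¹' Ici a = f ⁻¹' Ici (f z) from ext hz]
    exact (huF (f z) (by simp) (hm z)).trans fun y hy => le_trans haz hy

theorem IsProximitySpecker.add_smul_prec {v c : A} (hvc : v ≤ c) {k l : Idem S}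
    (hkl : idemRel prec k l) :
    prec (algebraMap A S v + (c - v) • k.val) (algebraMap A S v + (c - v) • l.val) := by
  refine h.proximity.add _ _ _ _ (h.prec_algebraMap v) ?_
  rcases hvc.eq_or_lt with rfl | hlt
  · simpa using h.proximity.zero
  · exact h.proximity.smul _ _ _ (sub_pos.2 hlt) hkl

theorem exists_isLevelEmbedding :
    ∃ η : S →ₐ[A] FN (EndSpace (idemRel prec)) A, IsLevelEmbedding A prec η := by
  have hf := h.fAlgebra
  have := hf.isOrderedRing
  have hc := h.isCompingent
  obtain ⟨η, hη⟩ := exists_algHom_represents h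
  have hidem : ∀ e : Idem S, ⇑(η e.val) = (zeta (idemRel prec) e).indicator 1 := fun e => by
    rw [(hη _).unique h (Represents.of_idem h e)]
    rfl
  have hinf : ∀ s t, η (s ⊓ t) = η s ⊓ η t := fun s t =>
    (hη _).unique h ((hη s).inf h (hη t))
  have hsup : ∀ s t, η (s ⊔ t) = η s ⊔ η t := fun s t =>
    (hη _).unique h ((hη s).sup h (hη t))
  have hinj : Function.Injective η := by
    rw [injective_iff_map_eq_zero]
    intro s hs
    exact (hs ▸ hη s : Represents prec s 0).eq_zero h
  have hle : ∀ {s t}, (∀ x, η s x ≤ η t x) → s ≤ t := fun {s t} hst => by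
    replace hst : η s ≤ η t := hst
    rw [← inf_eq_left, ← hinf] at hst
    exact inf_eq_left.1 (hinj hst)
  have happ : ∀ (v c : A) (k : Idem S), v ≤ c → ∀ y, η (algebraMap A S v + (c - v) • k.val) y =
      (c - v) * (zeta (idemRel prec) k).indicator 1 y + v := by
    intro v c k hvc y
    rw [map_add, AlgHom.commutes, map_smul, add_comm, FN.algebraMap_eq, FN.add_const_apply,
      FN.smul_apply (sub_nonneg.2 hvc), hidem]
  have hlev : ∀ s c, ∃ l : Idem S, ∀ x, c ≤ η s x ↔ x ∈ zeta (idemRel prec) l := fun s c => by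
    obtain ⟨l, hl, hl'⟩ := hf.exists_level h.specker s c
    exact ⟨l, (hη s).le_iff_mem_zeta h hl hl'⟩
  refine ⟨η, ⟨hidem, hinf, hsup, hinj, fun s t => ⟨fun hst c => ?_, fun hst => ?_⟩,
    fun f g hfg => ?_⟩, hlev⟩
  · obtain ⟨e, he⟩ := hlev s c
    obtain ⟨k, hk⟩ := hlev t c
    rw [show η s ⁻¹' Ici c = zeta (idemRel prec) e from ext he,
      show η t ⁻¹' Ici c = zeta (idemRel prec) k from ext hk]
    rcases (η t).exists_lower_cut c with hall | ⟨c', hc', htc⟩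
    · exact fun x _ => (hk x).1 (hall x)
    · rw [← hc.prec_iff_closure]
      have hcc := sub_pos.2 hc'
      refine h.proximity.of_smul _ _ _ hcc ?_
      -- Both sides are truncated to the interval from `c'` to `c`, where `η t` has no value
      -- strictly in between. After subtracting `c'`, the left side lies above `(c - c') e` and the
      -- right side below `(c - c') k`.
      have h1 : prec (s ⊔ algebraMap A S c') (t ⊔ algebraMap A S c') :=
        h.prec_sup (h.proximity.mono _ _ _ _ le_rfl hst le_sup_left)
          (h.proximity.mono _ _ _ _ le_rfl (h.prec_algebraMap c') le_sup_right)
      have h2 : prec ((s ⊔ algebraMap A S c') ⊓ algebraMap A S c)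
          ((t ⊔ algebraMap A S c') ⊓ algebraMap A S c) :=
        h.proximity.inf _ _ _ (h.proximity.mono _ _ _ _ inf_le_left h1 le_rfl)
          (h.proximity.mono _ _ _ _ inf_le_right (h.prec_algebraMap c) le_rfl)
      have h3 := h.proximity.add _ _ _ _ h2 (h.proximity.neg _ _ (h.prec_algebraMap c'))
      refine h.proximity.mono _ _ _ _ ?_ h3 ?_
      · rw [← sub_eq_add_neg, le_sub_iff_add_le, add_comm]
        refine hle fun x => ?_
        rw [happ _ _ _ hc'.le, hinf, FN.inf_apply, hsup, AlgHom.commutes, AlgHom.commutes,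
          FN.algebraMap_eq, FN.algebraMap_eq, FN.sup_const_apply, const_apply]
        by_cases hx : x ∈ zeta (idemRel prec) e
        · rw [indicator_of_mem hx]
          simpa using Or.inl ((he x).2 hx)
        · rw [indicator_of_notMem hx]
          simpa using hc'.le
      · rw [← sub_eq_add_neg, sub_le_iff_le_add']
        refine hle fun x => ?_
        rw [happ _ _ _ hc'.le, hinf, FN.inf_apply, hsup, AlgHom.commutes, AlgHom.commutes,
          FN.algebraMap_eq, FN.algebraMap_eq, FN.sup_const_apply, const_apply]
        by_cases hx : x ∈ zeta (idemRel prec) k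
        · rw [indicator_of_mem hx]
          simp
        · rw [indicator_of_notMem hx]
          simpa using Or.inl ((htc x).resolve_left (mt (hk x).1 hx))
  -- Reflection of the proximity: an approximant `u` with `η s ≺ η u` and `u ≺ t` satisfies `s ≤ u ≺
  -- t`.
  · obtain ⟨u, hut, hsu⟩ := exists_approx hc hidem hsup hst (fun u => prec u t)
      (fun _ _ => h.prec_sup) fun v c k hvc hv hk => by
        obtain ⟨l, hl⟩ := hlev t c
        have hkl : prec k.val l.val := hc.prec_iff_closure.2
          ((closure_zeta_subset_compl k).trans fun y hy => (hl y).1 (hk y hy))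
        refine h.proximity.mono _ _ _ _ le_rfl (h.add_smul_prec hvc hkl) (hle fun x => ?_)
        rw [happ _ _ _ hvc]
        by_cases hx : x ∈ zeta (idemRel prec) l
        · rw [indicator_of_mem hx]
          simpa using (hl x).2 hx
        · rw [indicator_of_notMem hx]
          simpa using hv x
    exact h.proximity.mono _ _ _ _ (hle (FN.le_of_prec hsu)) hut le_rfl
  · obtain ⟨u, hu, hfu⟩ := exists_approx hc hidem hsup hfg (fun u => (η u).prec g)
      (fun s t hs ht => by rw [hsup]; exact FN.prec_sup hs ht) fun v c k hvc hv hk b => by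
        by_cases hbv : b ≤ v
        · exact fun y _ => hbv.trans (hv y)
        · have hsub : η (algebraMap A S v + (c - v) • k.val) ⁻¹' Ici b ⊆
              zeta (idemRel prec) k := fun y hy => by
            by_contra hyk
            have hy' : b ≤ η (algebraMap A S v + (c - v) • k.val) y := hy
            rw [happ _ _ _ hvc, indicator_of_notMem hyk] at hy'
            exact hbv (by simpa using hy')
          by_cases hbc : b ≤ c
          · exact (closure_mono hsub).trans ((closure_zeta_subset_compl k).trans
              fun y hy => hbc.trans (hk y hy))
          · have hemp : η (algebraMap A S v + (c - v) • k.val) ⁻¹' Ici b = ∅ := by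
              refine eq_empty_of_forall_notMem fun y hy => ?_
              have hy' : b ≤ η (algebraMap A S v + (c - v) • k.val) y := hy
              rw [happ _ _ _ hvc, indicator_of_mem (hsub hy)] at hy'
              exact hbc (by simpa using hy')
            rw [hemp]
            simp
    exact ⟨u, hfu, hu⟩

end Representation

/-! ### Decreasing forms and proximity morphisms. -/

section Morphisms

open IsCompingent

/-- The generator `e` of the annihilator of `M` is the largest idempotent that kills `M`, so its
complement is the least upper bound. -/
theorem IsBaer.exists_isLUB {S : Type*} [CommRing S] (hB : IsBaer S) (M : Set (Idem S)) :
    ∃ a, IsLUB M a := by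
  obtain ⟨e, he, hM⟩ := hB (Idem.val '' M)
  let e' : Idem S := ⟨e, he⟩
  have hmem : ∀ s, (∀ m ∈ M, s * m.val = 0) ↔ e ∣ s := fun s => by
    rw [← Ideal.mem_span_singleton, ← SetLike.mem_coe, ← hM]
    simp
  refine ⟨e'ᶜ, fun m hm => ?_, fun u hu => ?_⟩
  · rw [Idem.le_iff, Idem.val_compl, mul_sub, mul_one, mul_comm,
      show e'.val * m.val = 0 from (hmem e).2 dvd_rfl m hm, sub_zero]
  · have : e ∣ uᶜ.val := (hmem _).1 fun m hm => by
      rw [Idem.val_compl, sub_mul, one_mul, mul_comm, Idem.le_iff.1 (hu hm), sub_self]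
    obtain ⟨r, hr⟩ := this
    rw [← compl_le_compl_iff_le, compl_compl, Idem.le_iff, hr]
    show e * r * e = e * r
    rw [mul_right_comm, he.eq]

theorem sum_succ_sub_castSucc {M : Type*} [AddCommGroup M] {n : ℕ} (w : Fin (n + 1) → M) :
    ∑ i : Fin n, (w i.succ - w i.castSucc) = w (Fin.last n) - w 0 := by
  induction n with
  | zero => simp
  | succ n ih =>
    rw [Fin.sum_univ_castSucc]
    have := ih fun i => w i.castSucc
    simp only [Fin.succ_castSucc, Fin.castSucc_zero] at this ⊢
    rw [this, Fin.succ_last]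
    abel

theorem eq_add_sum_of_strictMono {A : Type*} [CommRing A] [LinearOrder A] {n : ℕ}
    {v : Fin (n + 1) → A} (hv : StrictMono v) (j : Fin (n + 1)) :
    v 0 + ∑ i : Fin n, (v i.succ - v i.castSucc) * (if v i.succ ≤ v j then 1 else 0) = v j := by
  -- Writing each summand as a difference of values truncated at `v j` makes the sum telescope.
  have h : ∀ i : Fin n, (v i.succ - v i.castSucc) * (if v i.succ ≤ v j then 1 else 0) =
      v i.succ ⊓ v j - v i.castSucc ⊓ v j := by
    intro i
    split_ifs with hij
    · rw [inf_eq_left.2 hij, inf_eq_left.2 ((hv i.castSucc_lt_succ).le.trans hij), mul_one]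
    · rw [not_le, hv.lt_iff_lt] at hij
      have hij' : v j ≤ v i.castSucc := hv.monotone (Fin.le_castSucc_iff.2 hij)
      rw [inf_eq_right.2 hij', inf_eq_right.2 (hv hij).le, mul_zero, sub_self]
  rw [Finset.sum_congr rfl fun i _ => h i, sum_succ_sub_castSucc fun i => v i ⊓ v j,
    inf_eq_right.2 (hv.monotone (Fin.le_last j)), inf_eq_left.2 (hv.monotone (Fin.zero_le j))]
  abel

variable {A S : Type*} [CommRing A] [LinearOrder A] [IsOrderedRing A]
  [CommRing S] [Algebra A S] [Lattice S] {prec : S → S → Prop}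

namespace IsLevelEmbedding

variable {η : S →ₐ[A] FN (EndSpace (idemRel prec)) A} (hη : IsLevelEmbedding A prec η)
include hη

omit [IsOrderedRing A] in
theorem le_iff {s t : S} : s ≤ t ↔ ∀ x, η s x ≤ η t x := by
  rw [← inf_eq_left, ← hη.injective.eq_iff, hη.map_inf, inf_eq_left]
  rfl

theorem add_smul_apply {v c : A} (hvc : v ≤ c) (k : Idem S) (x : EndSpace (idemRel prec)) :
    η (algebraMap A S v + (c - v) • k.val) x =
      (c - v) * (zeta (idemRel prec) k).indicator 1 x + v := by
  rw [map_add, AlgHom.commutes, map_smul, add_comm, FN.algebraMap_eq, FN.add_const_apply,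
    FN.smul_apply (sub_nonneg.2 hvc), hη.map_idem]

variable (h : IsProximitySpecker A prec)
include h

/-- Below every element there are proximal elements that attain its value at a given end. -/
theorem exists_prec_apply_le (s : S) (y : EndSpace (idemRel prec)) :
    ∃ t, prec t s ∧ η s y ≤ η t y := by
  obtain ⟨l, hl⟩ := hη.exists_level s (η s y)
  obtain ⟨k, hkl, hyk⟩ := h.isCompingent.exists_prec_mem_zeta ((hl y).1 le_rfl)
  obtain ⟨_, ⟨⟨m, rfl⟩, hmin⟩⟩ := (η s).finite.exists_minimal ⟨η s y, mem_range_self y⟩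
  have hm : ∀ z, η s m ≤ η s z := fun z => (le_total (η s m) (η s z)).elim id
    fun hle => hmin (mem_range_self z) hle
  -- The witness takes the value of `s` at `y` on `zeta k` and the minimum of `η s` elsewhere.
  -- Replacing `k` by the level `l` gives an element still below `s`.
  refine ⟨_, h.proximity.mono _ _ _ _ le_rfl (h.add_smul_prec (hm y) hkl)
    (hη.le_iff.2 fun x => ?_), ?_⟩
  · rw [hη.add_smul_apply (hm y)]
    by_cases hx : x ∈ zeta (idemRel prec) l
    · rw [indicator_of_mem hx]
      simpa using (hl x).2 hx
    · rw [indicator_of_notMem hx]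
      simpa using hm x
  · rw [hη.add_smul_apply (hm y), indicator_of_mem hyk]
    simp

/-- Idempotents interpolate between an element and an idempotent proximal to it. -/
theorem exists_idem_between {t : S} {e : Idem S} (hte : prec t e.val) :
    ∃ k : Idem S, t ≤ k.val ∧ idemRel prec k e := by
  have hc := h.isCompingent
  have hpr := (hη.prec_iff _ _).1 hte
  have hle := hη.le_iff.1 (h.proximity.le _ _ hte)
  by_cases hpos : ∃ x, 0 < η t x
  · obtain ⟨x, hx⟩ := hpos
    -- With `m` the least positive value, `{0 < η t}` equals `{m ≤ η t}`, whose closure lies in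
    -- `zeta e` by proximity. The idempotent `k` is placed between them.
    obtain ⟨m, ⟨-, hm⟩, hmin⟩ :=
      ((η t).finite.subset (sep_subset (range (η t)) fun b => 0 < b)).exists_minimal
        ⟨η t x, mem_range_self x, hx⟩
    have hsub : closure (η t ⁻¹' Ici m) ⊆ zeta (idemRel prec) e := fun y hy => by
      by_contra hye
      have : m ≤ η e.val y := hpr m hy
      rw [hη.map_idem, indicator_of_notMem hye] at this
      exact absurd hm (not_lt.2 this)
    obtain ⟨k, hk, hke⟩ := hc.exists_prec_between isClosed_closure hsub
    refine ⟨k, hη.le_iff.2 fun y => ?_, hke⟩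
    rw [hη.map_idem]
    by_cases hy : y ∈ zeta (idemRel prec) k
    · rw [indicator_of_mem hy]
      refine (hle y).trans ?_
      rw [hη.map_idem]
      exact indicator_le_self' (by simp) y
    · rw [indicator_of_notMem hy]
      by_contra! hy0
      refine hy (hk (subset_closure ?_))
      exact (le_total m (η t y)).elim id fun hle => hmin ⟨mem_range_self y, hy0⟩ hle
  · push Not at hpos
    refine ⟨⊥, hη.le_iff.2 fun x => ?_, hc.mono le_rfl hc.bot bot_le⟩
    rw [Idem.val_bot, map_zero]
    exact hpos x

theorem exists_decreasingForm (s : S) : ∃ (n : ℕ) (a : A) (b : Fin n → A) (e : Fin n → Idem S),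
    IsDecreasingForm A b e ∧ s = algebraMap A S a + ∑ i, b i • (e i).val := by
  have hc := h.isCompingent
  rcases isEmpty_or_nonempty (EndSpace (idemRel prec)) with hemp | ⟨⟨y₀⟩⟩
  · exact ⟨0, 0, Fin.elim0, Fin.elim0, ⟨fun i => i.elim0, fun i => i.elim0, fun i => i.elim0,
      fun i => i.elim0⟩, hη.injective (FN.ext fun x => hemp.elim x)⟩
  have hne : (η s).finite.toFinset.Nonempty := ⟨η s y₀, by simp⟩
  -- There are `n + 1` values. The lowest becomes the constant term, and each of the `n` gaps
  -- contributes a coefficient with the level at its upper end.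
  obtain ⟨n, hn⟩ := Nat.exists_eq_succ_of_ne_zero (Finset.card_pos.2 hne).ne'
  set v := (η s).finite.toFinset.orderEmbOfFin hn with hv
  have hvm : StrictMono v := v.strictMono
  have hrange : range v = range (η s) := by
    rw [hv, Finset.range_orderEmbOfFin, Finite.coe_toFinset]
  have hval : ∀ j, ∃ y, η s y = v j := fun j => (hrange ▸ mem_range_self j : v j ∈ range (η s))
  have hidx : ∀ y, ∃ j, v j = η s y := fun y => (hrange ▸ mem_range_self y : η s y ∈ range v)
  choose l hl using hη.exists_level s
  have hb : ∀ i : Fin n, 0 < v i.succ - v i.castSucc := fun i =>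
    sub_pos.2 (hvm i.castSucc_lt_succ)
  have hanti : StrictAnti fun i : Fin n => l (v i.succ) := by
    intro i j hij
    have hlt : v i.succ < v j.succ := hvm (Fin.succ_lt_succ_iff.2 hij)
    refine lt_of_le_of_ne (hc.zeta_subset_iff.1 fun y hy =>
      (hl _ y).1 (hlt.le.trans ((hl _ y).2 hy))) fun heq => ?_
    obtain ⟨y, hy⟩ := hval i.succ
    have : y ∈ zeta (idemRel prec) (l (v j.succ)) := by
      rw [show l (v j.succ) = l (v i.succ) from heq]
      exact (hl _ y).1 hy.ge
    exact absurd ((hl _ y).2 this) (not_le.2 (hy ▸ hlt))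
  refine ⟨n, v 0, fun i => v i.succ - v i.castSucc, fun i => l (v i.succ),
    ⟨hb, fun i => ?_, hanti, fun i => ?_⟩, hη.injective (FN.ext fun y => ?_)⟩
  · rw [lt_top_iff_ne_top]
    intro heq
    obtain ⟨y, hy⟩ := hval 0
    have hmem : y ∈ zeta (idemRel prec) (l (v i.succ)) := by
      rw [heq, zeta_top]
      trivial
    exact absurd ((hl _ y).2 hmem) (not_le.2 (hy ▸ hvm i.succ_pos))
  · rw [bot_lt_iff_ne_bot]
    intro heq
    obtain ⟨y, hy⟩ := hval i.succ
    have hmem := (hl _ y).1 hy.ge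
    rw [heq, zeta_bot] at hmem
    exact hmem
  · simp only [map_add, map_sum, map_smul, AlgHom.commutes]
    rw [FN.decreasing_sum_apply _ (fun i => (hb i).le) (fun i => hη.map_idem _)
      fun i j hij => zeta_mono (hanti.antitone hij)]
    obtain ⟨j, hj⟩ := hidx y
    rw [← hj, ← eq_add_sum_of_strictMono hvm j]
    refine congrArg _ (Finset.sum_congr rfl fun i _ => ?_)
    rw [hη.map_idem, hj]
    congr 1
    by_cases hle : v i.succ ≤ η s y
    · rw [if_pos hle, indicator_of_mem ((hl _ y).1 hle)]
      rfl
    · rw [if_neg hle, indicator_of_notMem (mt (hl _ y).2 hle)]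

end IsLevelEmbedding

variable {T : Type*} [CommRing T] [Algebra A T] [Lattice T] {precT : T → T → Prop}

namespace IsProximityMorphism

variable {α : S → T} (hα : IsProximityMorphism A prec precT α)
include hα

omit [IsOrderedRing A] in
theorem map_algebraMap (a : A) : α (algebraMap A S a) = algebraMap A T a := by
  have := hα.map_add 0 a
  rwa [zero_add, hα.map_zero, zero_add] at this

omit [IsOrderedRing A] in
theorem monotone : Monotone α := fun s t hst => by
  have := hα.map_inf s t
  rw [inf_eq_left.2 hst] at this
  rw [this]
  exact inf_le_right

variable (hS : IsProximitySpecker A prec) (hT : IsProximitySpecker A precT)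
include hS hT

/-- Idempotency is the equation `2s ⊓ 1 = s`, which involves only operations that a proximity
morphism preserves. -/
theorem isIdempotentElem [Nontrivial A] (e : Idem S) : IsIdempotentElem (α e.val) := by
  have h2 : (0 : A) < 2 := two_pos
  refine hT.fAlgebra.two_nsmul_inf_one_iff.1 ?_
  have h := hS.fAlgebra.two_nsmul_inf_one_iff.2 e.isIdempotentElem
  rw [two_nsmul, ← two_smul A, ← map_one (algebraMap A S)] at h
  rw [two_nsmul, ← two_smul A, ← hα.map_smul _ _ h2, ← map_one (algebraMap A T),
    ← hα.map_algebraMap, ← hα.map_inf, h]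

/-- The restriction of a proximity morphism to the idempotents. -/
def restrict [Nontrivial A] (e : Idem S) : Idem T := ⟨α e.val, hα.isIdempotentElem hS hT e⟩

variable {ηS : S →ₐ[A] FN (EndSpace (idemRel prec)) A} (hηS : IsLevelEmbedding A prec ηS)
include hηS

theorem isDeVriesMorphism {σ : Idem S → Idem T} (hσ : ∀ e, (σ e).val = α e.val) :
    IsDeVriesMorphism (idemRel prec) (idemRel precT) σ where
  map_bot := Idem.val_injective (by rw [hσ, Idem.val_bot, hα.map_zero, Idem.val_bot])
  map_inf a b := Idem.val_injective (by
    rw [hσ, hS.fAlgebra.val_inf_eq, hα.map_inf, hT.fAlgebra.val_inf_eq, hσ, hσ])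
  map_prec a b hab := by
    have h1 := hα.map_add (-a.val) 1
    have h2 : (σ aᶜ)ᶜ.val = -α (-a.val) := by
      rw [map_one, map_one, neg_add_eq_sub] at h1
      rw [Idem.val_compl, hσ, Idem.val_compl, h1]
      ring
    show precT (σ aᶜ)ᶜ.val (σ b).val
    rw [h2, hσ]
    exact hα.map_prec _ _ hab
  isLUB e := by
    refine ⟨?_, fun u hu => ?_⟩
    · rintro _ ⟨k, hk, rfl⟩
      rw [← hT.fAlgebra.val_le_val_iff, hσ, hσ]
      exact hα.monotone (hS.proximity.le _ _ hk)
    · rw [← hT.fAlgebra.val_le_val_iff, hσ]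
      refine (hα.isLUB e.val).2 ?_
      rintro _ ⟨t, ht, rfl⟩
      -- The least upper bound for `α` ranges over all `t ≺ e`; interpolating idempotents are
      -- cofinal among them.
      obtain ⟨k, htk, hke⟩ := hηS.exists_idem_between hS ht
      refine (hα.monotone htk).trans ?_
      rw [← hσ, hT.fAlgebra.val_le_val_iff]
      exact hu (mem_image_of_mem σ hke)

variable {ηT : T →ₐ[A] FN (EndSpace (idemRel precT)) A} (hηT : IsLevelEmbedding A precT ηT)
include hηT

omit hS hT in
-- The two functions are compared level by level. Applying `α` to the truncation identity shows that
-- `{c ≤ η (α s)}` is `zeta (σ l)`, which is the level set of the pullback by the choice of `φ`.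
theorem eq_pullback {σ : Idem S → Idem T} (hσ : ∀ e, (σ e).val = α e.val)
    (φ : C(EndSpace (idemRel precT), EndSpace (idemRel prec)))
    (hφ : ∀ e, zeta (idemRel precT) (σ e)
      = interior (closure (φ ⁻¹' zeta (idemRel prec) e))) (s : S) :
    ηT (α s) = (ηS s).pullback φ := by
  refine FN.ext fun x => eq_of_forall_le_iff fun c => ?_
  obtain ⟨l, hl⟩ := hηS.exists_level s c
  rw [FN.le_pullback_iff, show ηS s ⁻¹' Ici c = zeta (idemRel prec) l from ext hl, ← hφ]
  rcases (ηS s).exists_lower_cut c with hall | ⟨c', hc', hcut⟩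
  · have hle : algebraMap A S c ≤ s := hηS.le_iff.2 fun y => by
      rw [AlgHom.commutes]; exact hall y
    have hle' := hηT.le_iff.1 (hα.map_algebraMap c ▸ hα.monotone hle) x
    rw [AlgHom.commutes] at hle'
    refine iff_of_true hle' ?_
    rw [hφ, eq_univ_of_forall fun y => (hl y).1 (hall y)]
    simp
  · have heq : (s ⊔ algebraMap A S c') ⊓ algebraMap A S c
        = algebraMap A S c' + (c - c') • l.val := by
      refine hηS.injective (FN.ext fun y => ?_)
      rw [hηS.add_smul_apply hc'.le, hηS.map_inf, FN.inf_apply, hηS.map_sup, AlgHom.commutes,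
        AlgHom.commutes, FN.algebraMap_eq, FN.algebraMap_eq, FN.sup_const_apply, const_apply]
      by_cases hy : y ∈ zeta (idemRel prec) l
      · rw [indicator_of_mem hy]
        simpa using Or.inl ((hl y).2 hy)
      · rw [indicator_of_notMem hy, sup_eq_right.2 ((hcut y).resolve_left (mt (hl y).1 hy))]
        simpa using hc'.le
    have heqT := congrArg α heq
    rw [hα.map_inf, hα.map_sup, hα.map_algebraMap, add_comm, hα.map_add,
      hα.map_smul _ _ (sub_pos.2 hc'), ← hσ, add_comm] at heqT
    have hx := congrArg (fun t => ηT t x) heqT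
    simp only [hηT.add_smul_apply hc'.le] at hx
    rw [hηT.map_inf, FN.inf_apply, hηT.map_sup, AlgHom.commutes, AlgHom.commutes,
      FN.algebraMap_eq, FN.algebraMap_eq, FN.sup_const_apply, const_apply] at hx
    by_cases hmem : x ∈ zeta (idemRel precT) (σ l)
    · rw [indicator_of_mem hmem] at hx
      refine iff_of_true ?_ hmem
      have hx' : (ηT (α s) x ⊔ c') ⊓ c = c := by simpa using hx
      exact (le_sup_iff.1 (inf_eq_right.1 hx')).resolve_right (not_le.2 hc')
    · rw [indicator_of_notMem hmem] at hx
      refine iff_of_false (fun hle => hc'.ne ?_) hmem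
      have hx' : (ηT (α s) x ⊔ c') ⊓ c = c' := by simpa using hx
      rw [← hx', inf_eq_right.2 (hle.trans le_sup_left)]

end IsProximityMorphism

variable (hS : IsProximitySpecker A prec)
  {ηS : S →ₐ[A] FN (EndSpace (idemRel prec)) A} (hηS : IsLevelEmbedding A prec ηS)
  {ηT : T →ₐ[A] FN (EndSpace (idemRel precT)) A} (hηT : IsLevelEmbedding A precT ηT)
include hηS hηT

theorem pullback_idem {σ : Idem S → Idem T}
    (φ : C(EndSpace (idemRel precT), EndSpace (idemRel prec)))
    (hφ : ∀ e, zeta (idemRel precT) (σ e)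
      = interior (closure (φ ⁻¹' zeta (idemRel prec) e))) (e : Idem S) :
    (ηS e.val).pullback φ = ηT (σ e).val := by
  refine FN.ext fun x => eq_of_forall_le_iff fun c => ?_
  rw [FN.le_pullback_iff, hηS.map_idem, hηT.map_idem]
  by_cases h0 : c ≤ 0
  · rw [show (zeta (idemRel prec) e).indicator
        (1 : EndSpace (idemRel prec) → A) ⁻¹' Ici c = univ from
      eq_univ_of_forall fun y => h0.trans (indicator_nonneg (by simp) y)]
    simpa using h0.trans (indicator_nonneg (by simp) x)
  · by_cases h1 : c ≤ 1
    · rw [show (zeta (idemRel prec) e).indicator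
        (1 : EndSpace (idemRel prec) → A) ⁻¹' Ici c = zeta (idemRel prec) e by
        ext y
        by_cases hy : y ∈ zeta (idemRel prec) e <;> simp [hy, h0, h1], ← hφ]
      by_cases hx : x ∈ zeta (idemRel precT) (σ e) <;> simp [hx, h0, h1]
    · rw [show (zeta (idemRel prec) e).indicator
        (1 : EndSpace (idemRel prec) → A) ⁻¹' Ici c = ∅ from
        eq_empty_of_forall_notMem fun y hy => h1 (le_trans hy (indicator_le_self' (by simp) y))]
      simpa using fun hc => h1 (le_trans hc (indicator_le_self' (by simp) x))

omit [CommRing T] [Algebra A T] [Lattice T] hηT in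
theorem pullback_decreasingForm {X : Type*} [TopologicalSpace X]
    (φ : C(X, EndSpace (idemRel prec))) {n : ℕ}
    (a : A) {b : Fin n → A} {e : Fin n → Idem S} (hbe : IsDecreasingForm A b e) :
    (ηS (algebraMap A S a + ∑ i, b i • (e i).val)).pullback φ
      = algebraMap A (FN X A) a + ∑ i, b i • (ηS (e i).val).pullback φ := by
  simp only [map_add, map_sum, map_smul, AlgHom.commutes]
  exact FN.pullback_decreasing_sum φ a (fun i => (hbe.pos i).le) (fun i => hηS.map_idem _)
    fun i j hij => zeta_mono (hbe.strictAnti.antitone hij)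

include hS in
-- A decreasing form pulls back to the same combination of the idempotents `σ (e i)`, so the
-- pullback stays in the image of `T` even without completeness.
theorem exists_eq_pullback {σ : Idem S → Idem T}
    (φ : C(EndSpace (idemRel precT), EndSpace (idemRel prec)))
    (hφ : ∀ e, zeta (idemRel precT) (σ e)
      = interior (closure (φ ⁻¹' zeta (idemRel prec) e))) (s : S) :
    ∃ t, ηT t = (ηS s).pullback φ := by
  obtain ⟨n, a, b, e, hbe, rfl⟩ := hηS.exists_decreasingForm hS s
  refine ⟨algebraMap A T a + ∑ i, b i • (σ (e i)).val, ?_⟩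
  rw [pullback_decreasingForm hηS φ a hbe]
  simp only [map_add, map_sum, map_smul, AlgHom.commutes, pullback_idem hηS hηT φ hφ]

include hS in
theorem isProximityMorphism_of_pullback {α : S → T}
    (φ : C(EndSpace (idemRel precT), EndSpace (idemRel prec)))
    (hα : ∀ s, ηT (α s) = (ηS s).pullback φ) : IsProximityMorphism A prec precT α where
  map_zero := hηT.injective (by
    rw [hα, map_zero, map_zero]
    exact FN.pullback_const φ 0)
  map_inf s t := hηT.injective (by
    rw [hα, hηS.map_inf, hηT.map_inf, hα, hα, FN.pullback_inf])
  map_prec s t hst := by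
    rw [hηT.prec_iff, map_neg, hα, hα, map_neg]
    exact FN.neg_pullback_neg_prec φ ((hηS.prec_iff _ _).1 hst)
  isLUB s := by
    refine ⟨?_, fun u hu => ?_⟩
    · rintro _ ⟨t, ht, rfl⟩
      rw [hηT.le_iff, hα, hα]
      exact FN.pullback_mono φ (hηS.le_iff.1 (hS.proximity.le _ _ ht))
    · rw [hηT.le_iff, hα]
      -- It suffices to bound the composition, and at `φ x` the value of `s` is attained by some `t
      -- ≺ s`.
      refine (FN.pullback_le_iff φ _ _).2 fun x => ?_
      obtain ⟨t, hts, hle⟩ := hηS.exists_prec_apply_le hS s (φ x)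
      refine hle.trans ((FN.apply_le_pullback φ _ x).trans ?_)
      rw [← hα]
      exact hηT.le_iff.1 (hu (mem_image_of_mem α hts)) x
  map_add s a := hηT.injective (by
    rw [hα, map_add, map_add, AlgHom.commutes, AlgHom.commutes, hα]
    exact FN.pullback_add_const φ _ a)
  map_smul s a ha := hηT.injective (by
    rw [hα, map_smul, map_smul, hα, FN.pullback_smul φ ha.le])
  map_sup s a := hηT.injective (by
    rw [hα, hηS.map_sup, hηT.map_sup, AlgHom.commutes, AlgHom.commutes, hα]
    exact FN.pullback_sup_const φ _ a)

end Morphisms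

end DeVriesPower

open DeVriesPower

/-! ### Equivalence, extension and the Baer correspondences. -/

theorem mainTheorem5 {A S T : Type*}
    [CommRing A] [IsDomain A] [LinearOrder A] [IsOrderedRing A]
    [CommRing S] [Algebra A S] [Lattice S] [CommRing T] [Algebra A T] [Lattice T]
    (precS : S → S → Prop) (precT : T → T → Prop)
    (hS : IsProximitySpecker A precS) (hT : IsProximitySpecker A precT) :
    ∃ (ηS : S →ₐ[A] FN (EndSpace (idemRel precS)) A)
      (ηT : T →ₐ[A] FN (EndSpace (idemRel precT)) A),
      IsCanonicalEmbedding A precS ηS ∧ IsCanonicalEmbedding A precT ηT ∧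
      -- the characterization of proximity morphisms
      (∀ α : S → T, List.TFAE [
        IsProximityMorphism A precS precT α,
        (∃ σ : Idem S → Idem T, (∀ e, (σ e).val = α e.val) ∧
            IsDeVriesMorphism (idemRel precS) (idemRel precT) σ) ∧
          (∀ (n : ℕ) (a : A) (b : Fin n → A) (e : Fin n → Idem S), IsDecreasingForm A b e →
            α (algebraMap A S a + ∑ i, b i • (e i).val)
              = algebraMap A T a + ∑ i, b i • α (e i).val),
        ∃ φ : C(EndSpace (idemRel precT), EndSpace (idemRel precS)),
          ∀ s, ηT (α s) = (ηS s).pullback φ]) ∧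
      -- the unique extension of de Vries morphisms
      (∀ σ : Idem S → Idem T, IsDeVriesMorphism (idemRel precS) (idemRel precT) σ →
        ∃! α : S → T, IsProximityMorphism A precS precT α ∧ ∀ e, α e.val = (σ e).val) ∧
      -- the correspondences in the Baer case
      (IsBaer S → IsBaer T →
        ∃ (F : {α : S → T // IsProximityMorphism A precS precT α} ≃
              {σ : Idem S → Idem T // IsDeVriesMorphism (idemRel precS) (idemRel precT) σ})
          (G : {σ : Idem S → Idem T // IsDeVriesMorphism (idemRel precS) (idemRel precT) σ} ≃
              C(EndSpace (idemRel precT), EndSpace (idemRel precS))),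
          (∀ α e, ((F α).1 e).val = α.1 e.val) ∧
          (∀ σ e, zeta (idemRel precT) (σ.1 e)
            = interior (closure (G σ ⁻¹' zeta (idemRel precS) e))) ∧
          (∀ α s, ηT (α.1 s) = (ηS s).pullback (G (F α)))) := by
  obtain ⟨ηS, hηS⟩ := exists_isLevelEmbedding hS
  obtain ⟨ηT, hηT⟩ := exists_isLevelEmbedding hT
  have hcS := hS.isCompingent
  have hcT := hT.isCompingent
  let dual : ∀ σ : Idem S → Idem T, IsDeVriesMorphism (idemRel precS) (idemRel precT) σ →
      C(EndSpace (idemRel precT), EndSpace (idemRel precS)) := fun σ hσ =>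
    ⟨hσ.endMap hcS hcT, hσ.continuous_endMap hcS hcT⟩
  have hdual : ∀ σ hσ e, zeta (idemRel precT) (σ e)
      = interior (closure (dual σ hσ ⁻¹' zeta (idemRel precS) e)) := fun σ hσ e =>
    hσ.zeta_map hcS hcT e
  have hext : ∀ σ : Idem S → Idem T, IsDeVriesMorphism (idemRel precS) (idemRel precT) σ →
      ∃! α : S → T, IsProximityMorphism A precS precT α ∧ ∀ e, α e.val = (σ e).val := by
    intro σ hσ
    choose α hα using exists_eq_pullback hS hηS hηT (dual σ hσ) (hdual σ hσ)
    refine ⟨α, ⟨isProximityMorphism_of_pullback hS hηS hηT _ hα, fun e => hηT.injective ?_⟩,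
      ?_⟩
    · rw [hα, pullback_idem hηS hηT _ (hdual σ hσ)]
    · rintro β ⟨hβ, hβσ⟩
      funext s
      refine hηT.injective ?_
      rw [hα, hβ.eq_pullback hηS hηT (fun e => (hβσ e).symm) _ (hdual σ hσ)]
  refine ⟨ηS, ηT, hηS.toIsCanonicalEmbedding, hηT.toIsCanonicalEmbedding, fun α => ?_, hext,
    fun _ hBT => ?_⟩
  · tfae_have 1 → 3 := fun hα => by
      have hσ : IsDeVriesMorphism _ _ (hα.restrict hS hT) :=
        hα.isDeVriesMorphism hS hT hηS fun _ => rfl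
      exact ⟨dual _ hσ, hα.eq_pullback hηS hηT (fun _ => rfl) _ (hdual _ hσ)⟩
    tfae_have 3 → 1 := fun ⟨φ, hφ⟩ => isProximityMorphism_of_pullback hS hηS hηT φ hφ
    tfae_have 2 → 3 := fun ⟨⟨σ, hσα, hσ⟩, hform⟩ => by
      refine ⟨dual σ hσ, fun s => ?_⟩
      obtain ⟨n, a, b, e, hbe, rfl⟩ := hηS.exists_decreasingForm hS s
      rw [hform n a b e hbe, pullback_decreasingForm hηS _ a hbe]
      simp only [map_add, map_sum, map_smul, AlgHom.commutes, ← hσα,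
        pullback_idem hηS hηT _ (hdual σ hσ)]
    tfae_have 3 → 2 := fun ⟨φ, hφ⟩ => by
      have hα := isProximityMorphism_of_pullback hS hηS hηT φ hφ
      refine ⟨⟨hα.restrict hS hT, fun _ => rfl, hα.isDeVriesMorphism hS hT hηS fun _ => rfl⟩,
        fun n a b e hbe => hηT.injective ?_⟩
      rw [hφ, pullback_decreasingForm hηS φ a hbe]
      simp only [map_add, map_sum, map_smul, AlgHom.commutes, hφ]
    tfae_finish
  · refine ⟨Equiv.ofBijective (fun α => ⟨α.2.restrict hS hT,
        α.2.isDeVriesMorphism hS hT hηS fun _ => rfl⟩) ⟨fun α β hαβ => ?_, fun σ => ?_⟩,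
      Equiv.ofBijective (fun σ => dual σ.1 σ.2) ⟨fun σ τ hστ => ?_, fun φ => ?_⟩,
      fun _ _ => rfl, fun σ e => hdual σ.1 σ.2 e, fun α s => ?_⟩
    · have hval : ∀ e : Idem S, α.1 e.val = β.1 e.val := fun e =>
        congrArg (fun σ : {σ : Idem S → Idem T //
          IsDeVriesMorphism (idemRel precS) (idemRel precT) σ} => (σ.1 e).val) hαβ
      exact Subtype.ext ((hext _ (α.2.isDeVriesMorphism hS hT hηS
        (σ := α.2.restrict hS hT) fun _ => rfl)).unique ⟨α.2, fun _ => rfl⟩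
          ⟨β.2, fun e => (hval e).symm⟩)
    · obtain ⟨α, ⟨hα, hασ⟩, -⟩ := hext σ.1 σ.2
      exact ⟨⟨α, hα⟩, Subtype.ext (funext fun e => Idem.val_injective (hασ e))⟩
    · refine Subtype.ext (funext fun e => hcT.zeta_injective ?_)
      have hστ' : dual σ.1 σ.2 = dual τ.1 τ.2 := hστ
      rw [hdual _ σ.2, hdual _ τ.2, hστ']
    -- Surjectivity: the Baer property makes the idempotents of `T` complete, so each regular open
    -- set obtained from `φ` is `zeta` of an idempotent, which defines `σ e`.
    · choose σ hσ using fun e : Idem S => hcT.exists_zeta_eq hBT.exists_isLUB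
        (U := interior (closure (φ ⁻¹' zeta (idemRel precS) e))) interior_closure_idem
      have hdV := isDeVriesMorphism_of_zeta hcS hcT φ hσ
      refine ⟨⟨σ, hdV⟩, eq_of_interior_closure_preimage_eq hcS _ _ fun e => ?_⟩
      rw [← hσ]
      exact (hdual σ hdV e).symm
    · exact α.2.eq_pullback hηS hηT (fun _ => rfl) _
        (hdual _ (α.2.isDeVriesMorphism hS hT hηS fun _ => rfl)) s
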